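/- Let $q$ be a complex number with $|q|=1$, let $(T_1,T_2)$ be a pair of contractions on a complex Hilbert space $\mathcal H$ with $T_1T_2=qT_2T_1$, and put $T=T_1T_2$. For a contraction $A$ write $D_A=(I-A^*A)^{1/2}$ and $\mathcal D_A=\overline{\operatorname{Ran}}\,D_A$. For a Hilbert space $\mathcal F$ let $H^2(\mathcal F)$ be the Hardy space of $\mathcal F$-valued functions on the unit disc with square-summable Taylor coefficients, let $(R_qf)(z)=f(qz)$, and let $M_\varphi$ be multiplication by $\varphi$. *Canonical pair.* Let $Q_{T^*}\ge 0$ be given by $Q_{T^*}^2=\lim_n T^nT^{*n}$ (strong limit). Let $W_D^*$ on $\mathcal Q_{T^*}\supseteq\overline{\operatorname{Ran}}\,Q_{T^*}$ be the minimal unitary extension of the isometry $Q_{T^*}h\mapsto Q_{T^*}T^*h$, so that $\mathcal Q_{T^*}=\bigvee_{n\ge0}W_D^n\,\overline{\operatorname{Ran}}\,Q_{T^*}$. The canonical pair $(W_1,W_2)$ is the pair of unitaries on $\mathcal Q_{T^*}$ with $W_1W_2=qW_2W_1$, $W_1^*W_2^*=qW_D^*$ and $W_j^*Q_{T^*}h=Q_{T^*}T_j^*h$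 for $h\in\mathcal H$, $j=1,2$. *Andô tuples.* A special Andô tuple $(\mathcal F_*,\Lambda_*,P_*,U_*)$ for $(T_1^*,T_2^*)$ consists of a space $\mathcal F_*=\mathcal D_{T_1^*}\oplus\mathcal D_{T_2^*}\oplus\mathcal E$ for some (possibly zero) Hilbert space $\mathcal E$, the isometry $\Lambda_*:\mathcal D_{T^*}\to\mathcal F_*$ with $\Lambda_*D_{T^*}h=D_{T_1^*}T_2^*h\oplus D_{T_2^*}h\oplus0$, the orthogonal projection $P_*$ of $\mathcal F_*$ onto $\mathcal D_{T_1^*}\oplus0\oplus0$, and a unitary $U_*$ on $\mathcal F_*$ with $U_*(D_{T_1^*}T_2^*h\oplus D_{T_2^*}h\oplus0)=D_{T_1^*}h\oplus D_{T_2^*}T_1^*h\oplus0$ for all $h\in\mathcal H$. An Andô tuple for $(T_1^*,T_2^*)$ consists of a Hilbert space $\mathcal F_*$, an isometry $\Lambda_*:\mathcal D_{T^*}\to\mathcal F_*$, an orthogonal projection $P_*$ and a unitary $U_*$ on $\mathcal F_*$ with $$\Lambda_*D_{T^*}T_1^*=P_*^\perp U_*\Lambda_*D_{T^*}+P_*U_*\Lambda_*D_{T^*}T^*,\qquad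 \Lambda_*D_{T^*}T_2^*=U_*^*P_*\Lambda_*D_{T^*}+qU_*^*P_*^\perp\Lambda_*D_{T^*}T^*,$$ where $P_*^\perp=I-P_*$. *Model.* For such a tuple put, on $H^2(\mathcal F_*)\oplus\mathcal Q_{T^*}$, $$V_1^D=M_{U_*^*(P_*^\perp+zP_*)}R_q\oplus W_1,\qquad V_2^D=R_{\bar q}M_{(P_*+zP_*^\perp)U_*}\oplus W_2,$$ and define $\Pi_D:\mathcal H\to H^2(\mathcal D_{T^*})\oplus\mathcal Q_{T^*}$ and $\Pi^D:\mathcal H\to H^2(\mathcal F_*)\oplus\mathcal Q_{T^*}$ by $$\Pi_Dh=\Big(\sum_{n\ge0}z^nD_{T^*}T^{*n}h\Big)\oplus Q_{T^*}h,\qquad \Pi^Dh=\big((I_{H^2}\otimes\Lambda_*)\oplus I_{\mathcal Q_{T^*}}\big)\Pi_Dh=\Big(\sum_{n\ge0}z^n\Lambda_*D_{T^*}T^{*n}h\Big)\oplus Q_{T^*}h.$$ *Lifts.* A $q$-commuting isometric lift of $(T_1,T_2)$ is a triple $(\Pi;V_1,V_2)$ of an isometry $\Pi:\mathcal H\to\mathcal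 K$ into a Hilbert space and isometries $V_1,V_2$ on $\mathcal K$ with $V_1V_2=qV_2V_1$ and $V_j^*\Pi=\Pi T_j^*$ ($j=1,2$); it is minimal if $\mathcal K=\bigvee_{m,n\ge0}V_1^mV_2^n\Pi\mathcal H$. **Theorem.** The canonical pair and a special Andô tuple for $(T_1^*,T_2^*)$ exist. For every special Andô tuple for $(T_1^*,T_2^*)$, $\Pi^D$ is an isometry and $(\Pi^D;V_1^D,V_2^D)$ is a $q$-commuting isometric lift of $(T_1,T_2)$. Conversely, for every minimal $q$-commuting isometric lift $(\Pi;V_1,V_2)$ of $(T_1,T_2)$ on $\mathcal K$ there are an Andô tuple $(\mathcal F_*,\Lambda_*,P_*,U_*)$ for $(T_1^*,T_2^*)$ and a unitary $\tau:\mathcal K\to H^2(\mathcal F_*)\oplus\mathcal Q_{T^*}$ such that $\tau V_j=V_j^D\tau$ for $j=1,2$ and $\tau\Pi=\Pi^D$, with $V_j^D$ and $\Pi^D$ formed from this tuple and the canonical pair. -/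

import Mathlib

open Filter Topology ContinuousLinearMap
open scoped ENNReal

set_option linter.unusedSectionVars false

noncomputable section

namespace QDouglas

universe u v w x

section Contraction

variable {H : Type u} [NormedAddCommGroup H] [InnerProductSpace ℂ H] [CompleteSpace H]

/-- `(T₁, T₂)` is a `q`-commuting pair of contractions: `T₁ T₂ = q T₂ T₁`. -/
structure IsQContractivePair (q : Circle) (T₁ T₂ : H →L[ℂ] H) : Prop where
  norm_le₁ : ‖T₁‖ ≤ 1
  norm_le₂ : ‖T₂‖ ≤ 1
  qcomm : T₁ * T₂ = (q : ℂ) • (T₂ * T₁)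

/-- The defect operator `D_T = (I - T* T)^{1/2}`. -/
def defect (T : H →L[ℂ] H) : H →L[ℂ] H := CFC.sqrt (1 - adjoint T * T)

/-- The closure of the range of an operator. -/
abbrev closedRange (A : H →L[ℂ] H) : Submodule ℂ H := A.range.topologicalClosure

/-- The vector `A h` as an element of the closure of the range of `A`. -/
def toClosedRange (A : H →L[ℂ] H) : H →L[ℂ] closedRange A :=
  A.codRestrict (closedRange A) fun h => A.range.le_topologicalClosure ⟨h, rfl⟩

/-- The defect space `𝒟_T`, the closure of the range of `D_T`. -/
abbrev defectSpace (T : H →L[ℂ] H) : Submodule ℂ H := closedRange (defect T)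

/-- `D_T` as an operator from `H` to the defect space of `T`. -/
abbrev toDefect (T : H →L[ℂ] H) : H →L[ℂ] defectSpace T := toClosedRange (defect T)

lemma one_sub_nonneg {T : H →L[ℂ] H} (hT : ‖T‖ ≤ 1) : 0 ≤ 1 - adjoint T * T := by
  rw [nonneg_iff_isPositive, ContinuousLinearMap.isPositive_iff_complex]
  intro h
  have h1 : inner ℂ ((1 - adjoint T * T) h) h = ((‖h‖ ^ 2 - ‖T h‖ ^ 2 : ℝ) : ℂ) := by
    simp [adjoint_inner_left, inner_self_eq_norm_sq_to_K]
  have h2 : ‖T h‖ ≤ ‖h‖ := T.le_of_opNorm_le_of_le hT le_rfl |>.trans (by simp)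
  have h3 : ‖T h‖ ^ 2 ≤ ‖h‖ ^ 2 := by gcongr
  rw [h1]
  constructor
  · norm_cast
  · rw [RCLike.re_to_complex, Complex.ofReal_re]
    linarith

lemma norm_sqrt_sq {A : H →L[ℂ] H} (hA : 0 ≤ A) (h : H) :
    ((‖CFC.sqrt A h‖ ^ 2 : ℝ) : ℂ) = inner ℂ (A h) h := by
  have hs : adjoint (CFC.sqrt A) = CFC.sqrt A :=
    ((nonneg_iff_isPositive _).1 (CFC.sqrt_nonneg A)).isSelfAdjoint.adjoint_eq
  conv_rhs => rw [← CFC.sqrt_mul_sqrt_self A hA]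
  rw [mul_apply_eq_comp, ← adjoint_inner_right, hs, inner_self_eq_norm_sq_to_K]
  norm_cast

lemma norm_defect_sq {T : H →L[ℂ] H} (hT : ‖T‖ ≤ 1) (h : H) :
    ‖defect T h‖ ^ 2 = ‖h‖ ^ 2 - ‖T h‖ ^ 2 := by
  have := norm_sqrt_sq (one_sub_nonneg hT) h
  have h1 : inner ℂ ((1 - adjoint T * T) h) h = ((‖h‖ ^ 2 - ‖T h‖ ^ 2 : ℝ) : ℂ) := by
    simp [adjoint_inner_left, inner_self_eq_norm_sq_to_K]
  rw [h1] at this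
  exact_mod_cast this

lemma norm_apply_le {T : H →L[ℂ] H} (hT : ‖T‖ ≤ 1) (h : H) : ‖T h‖ ≤ ‖h‖ := by
  simpa using T.le_of_opNorm_le hT h

lemma norm_adjoint_le {T : H →L[ℂ] H} (hT : ‖T‖ ≤ 1) : ‖adjoint T‖ ≤ 1 := by
  simpa using hT

lemma norm_pow_le_one {T : H →L[ℂ] H} (hT : ‖T‖ ≤ 1) (n : ℕ) : ‖T ^ n‖ ≤ 1 := by
  refine opNorm_le_bound _ zero_le_one fun h => ?_
  rw [one_mul]
  induction n with
  | zero => simp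
  | succ n ih =>
    rw [pow_succ', mul_apply_eq_comp]
    exact (norm_apply_le hT _).trans ih

lemma norm_sub_mul_adjoint_sq {S : H →L[ℂ] H} (hS : ‖S‖ ≤ 1) (y : H) :
    ‖y - S (adjoint S y)‖ ^ 2 ≤ ‖y‖ ^ 2 - ‖adjoint S y‖ ^ 2 := by
  have h1 : RCLike.re (inner ℂ y (S (adjoint S y))) = ‖adjoint S y‖ ^ 2 := by
    rw [← adjoint_inner_left, inner_self_eq_norm_sq]
  have h2 : ‖S (adjoint S y)‖ ^ 2 ≤ ‖adjoint S y‖ ^ 2 := by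
    gcongr
    exact norm_apply_le hS _
  rw [norm_sub_sq (𝕜 := ℂ), h1]
  linarith

lemma cauchySeq_pow {T : H →L[ℂ] H} (hT : ‖T‖ ≤ 1) (h : H) :
    CauchySeq fun n : ℕ => (T ^ n * adjoint T ^ n) h := by
  set a : ℕ → ℝ := fun n => ‖(adjoint T ^ n) h‖ ^ 2 with ha
  have hanti : Antitone a := by
    refine antitone_nat_of_succ_le fun n => ?_
    have h1 : ‖(adjoint T ^ (n + 1)) h‖ ≤ ‖(adjoint T ^ n) h‖ := by
      rw [pow_succ', mul_apply_eq_comp]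
      exact norm_apply_le (norm_adjoint_le hT) _
    exact pow_le_pow_left₀ (norm_nonneg _) h1 2
  have hbdd : BddBelow (Set.range a) := ⟨0, by rintro _ ⟨n, rfl⟩; positivity⟩
  have hlim := tendsto_atTop_ciInf hanti hbdd
  have key : ∀ n k, ‖(T ^ n * adjoint T ^ n) h - (T ^ (n + k) * adjoint T ^ (n + k)) h‖ ^ 2
      ≤ a n - a (n + k) := by
    intro n k
    have e : (T ^ n * adjoint T ^ n) h - (T ^ (n + k) * adjoint T ^ (n + k)) h =
        (T ^ n) ((adjoint T ^ n) h - (T ^ k) (adjoint (T ^ k) ((adjoint T ^ n) h))) := by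
      have h3 : adjoint (T ^ k) = adjoint T ^ k := by
        simp only [← star_eq_adjoint, star_pow]
      rw [map_sub, h3, pow_add T, add_comm n k, pow_add (adjoint T)]
      rfl
    have h3 : adjoint (T ^ k) = adjoint T ^ k := by
      simp only [← star_eq_adjoint, star_pow]
    rw [e]
    calc _ ≤ ‖(adjoint T ^ n) h - (T ^ k) (adjoint (T ^ k) ((adjoint T ^ n) h))‖ ^ 2 := by
          gcongr
          exact norm_apply_le (norm_pow_le_one hT n) _
      _ ≤ _ := norm_sub_mul_adjoint_sq (norm_pow_le_one hT k) _
      _ = a n - a (n + k) := by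
          rw [h3]
          simp only [ha]
          rw [add_comm n k, pow_add (adjoint T)]
          rfl
  rw [Metric.cauchySeq_iff']
  intro ε hε
  obtain ⟨N, hN⟩ := (Metric.tendsto_atTop.1 hlim) (ε ^ 2) (by positivity)
  refine ⟨N, fun n hn => ?_⟩
  obtain ⟨k, rfl⟩ := Nat.exists_eq_add_of_le hn
  rw [dist_comm, dist_eq_norm]
  have h1 := key N k
  have h2 := hN N le_rfl
  rw [Real.dist_eq] at h2
  have h3 := (le_abs_self _).trans_lt h2
  have h4 := ciInf_le hbdd (N + k)
  exact lt_of_pow_lt_pow_left₀ 2 hε.le (by linarith)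

lemma exists_asymptoticLimit {T : H →L[ℂ] H} (hT : ‖T‖ ≤ 1) :
    ∃ A : H →L[ℂ] H, ∀ h, Tendsto (fun n : ℕ => (T ^ n * adjoint T ^ n) h) atTop (𝓝 (A h)) := by
  choose f hf using fun h => cauchySeq_tendsto_of_complete (cauchySeq_pow hT h)
  refine ⟨ofTendstoOfBoundedRange f (fun n : ℕ => T ^ n * adjoint T ^ n)
    (tendsto_pi_nhds.2 hf) ?_, hf⟩
  refine (Metric.isBounded_closedBall (x := (0 : H →L[ℂ] H)) (r := 1)).subset ?_
  rintro _ ⟨n, rfl⟩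
  rw [mem_closedBall_zero_iff]
  refine (norm_mul_le _ _).trans ?_
  exact mul_le_one₀ (norm_pow_le_one hT n) (norm_nonneg _)
    (norm_pow_le_one (norm_adjoint_le hT) n)

/-- The limit of `Tⁿ T*ⁿ` in the strong operator topology, for a contraction `T`. -/
def asymptoticLimit (T : H →L[ℂ] H) (hT : ‖T‖ ≤ 1) : H →L[ℂ] H :=
  (exists_asymptoticLimit hT).choose

lemma tendsto_asymptoticLimit {T : H →L[ℂ] H} (hT : ‖T‖ ≤ 1) (h : H) :
    Tendsto (fun n : ℕ => (T ^ n * adjoint T ^ n) h) atTop (𝓝 (asymptoticLimit T hT h)) :=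
  (exists_asymptoticLimit hT).choose_spec h

lemma asymptoticLimit_nonneg {T : H →L[ℂ] H} (hT : ‖T‖ ≤ 1) : 0 ≤ asymptoticLimit T hT := by
  rw [nonneg_iff_isPositive, ContinuousLinearMap.isPositive_iff_complex]
  intro h
  have h1 : ∀ n : ℕ, inner ℂ ((T ^ n * adjoint T ^ n) h) h =
      ((‖(adjoint T ^ n) h‖ ^ 2 : ℝ) : ℂ) := by
    intro n
    have h3 : adjoint (T ^ n) = adjoint T ^ n := by
      simp only [← star_eq_adjoint, star_pow]
    rw [mul_apply_eq_comp, ← adjoint_inner_right, h3, inner_self_eq_norm_sq_to_K]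
    norm_cast
  have h2 : Tendsto (fun n : ℕ => ((‖(adjoint T ^ n) h‖ ^ 2 : ℝ) : ℂ)) atTop
      (𝓝 (inner ℂ (asymptoticLimit T hT h) h)) := by
    simpa only [h1] using (tendsto_asymptoticLimit hT h).inner (𝕜 := ℂ) (tendsto_const_nhds (x := h))
  have hre := (Complex.continuous_re.tendsto _).comp h2
  have him := (Complex.continuous_im.tendsto _).comp h2
  have him0 : (inner ℂ (asymptoticLimit T hT h) h).im = 0 :=
    tendsto_nhds_unique him (by
      simp only [Function.comp_def, Complex.ofReal_im]
      exact tendsto_const_nhds)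
  refine ⟨?_, ?_⟩
  · apply Complex.ext
    · simp
    · simp [him0]
  · exact ge_of_tendsto' hre fun n => by simp only [Function.comp_apply, Complex.ofReal_re]; positivity

/-- The operator `Q_{T*}`: the positive square root of the strong limit of `Tⁿ T*ⁿ`. -/
def Qop (T : H →L[ℂ] H) (hT : ‖T‖ ≤ 1) : H →L[ℂ] H := CFC.sqrt (asymptoticLimit T hT)

lemma Qop_mul_self {T : H →L[ℂ] H} (hT : ‖T‖ ≤ 1) :
    Qop T hT * Qop T hT = asymptoticLimit T hT :=
  CFC.sqrt_mul_sqrt_self _ (asymptoticLimit_nonneg hT)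

end Contraction

section Hardy

variable {F : Type v} [NormedAddCommGroup F] [InnerProductSpace ℂ F]
variable {G : Type w} [NormedAddCommGroup G] [InnerProductSpace ℂ G]

/-- The vector-valued Hardy space `H²(F)`: the function `∑ zⁿ aₙ` on the unit disc is given by its
square-summable sequence `(aₙ)` of Taylor coefficients in `F`. -/
abbrev H2 (F : Type v) [NormedAddCommGroup F] : Type v := lp (fun _ : ℕ => F) 2

/-- The value at `z` of an element of `H²(F)`. -/
def H2.eval (f : H2 F) (z : ℂ) : F := ∑' n : ℕ, z ^ n • f n

/-- The operator `I ⊗ A : H²(F) → H²(G)`, i.e. `(I ⊗ A) f (z) = A (f z)`. -/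
def tensorId (A : F →L[ℂ] G) : H2 F →L[ℂ] H2 G :=
  lp.mapCLM 2 (fun _ : ℕ => A) (norm_nonneg A) fun _ => le_rfl

/-- The rotation `R_q` on `H²(F)`, i.e. `R_q f (z) = f (q z)`. -/
def rotation (F : Type v) [NormedAddCommGroup F] [InnerProductSpace ℂ F] (q : Circle) :
    H2 F →L[ℂ] H2 F :=
  lp.mapCLM 2 (fun n : ℕ => ((q : ℂ) ^ n) • ContinuousLinearMap.id ℂ F) zero_le_one fun n => by
    refine (norm_smul_le _ _).trans ?_
    rw [norm_pow, Circle.norm_coe, one_pow, one_mul]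
    exact norm_id_le

/-- The coefficient sequence of `z f(z)`. -/
def shiftFun (f : ℕ → F) : ℕ → F
  | 0 => 0
  | n + 1 => f n

lemma hasSum_shiftFun (f : H2 F) :
    HasSum (fun n => ‖shiftFun f n‖ ^ (2 : ℝ≥0∞).toReal) (‖f‖ ^ (2 : ℝ≥0∞).toReal) := by
  have h := lp.hasSum_norm (p := 2) (by norm_num) f
  rw [← hasSum_nat_add_iff' 1]
  simpa [shiftFun] using h

/-- The shift `M_z` on `H²(F)`, i.e. `M_z f (z) = z f(z)`. -/
def shift (F : Type v) [NormedAddCommGroup F] [InnerProductSpace ℂ F] : H2 F →L[ℂ] H2 F :=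
  LinearMap.mkContinuous
    { toFun f := ⟨shiftFun f, memℓp_gen (hasSum_shiftFun f).summable⟩
      map_add' f g := by
        ext n
        rcases n with _ | n
        · exact (add_zero (0 : F)).symm
        · rfl
      map_smul' c f := by
        ext n
        rcases n with _ | n
        · exact (smul_zero c).symm
        · rfl }
    1 fun f => by
      have h1 := lp.hasSum_norm (p := 2) (by norm_num)
        (⟨shiftFun f, memℓp_gen (hasSum_shiftFun f).summable⟩ : H2 F)
      have h2 := h1.unique (hasSum_shiftFun f)
      rw [one_mul]
      refine le_of_eq ?_
      simpa using h2

/-- The multiplication operator `M_φ` on `H²(F)` with the operator-valued symbol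
`φ(z) = A + z B`. -/
def mulOp (A B : F →L[ℂ] F) : H2 F →L[ℂ] H2 F := tensorId A + shift F * tensorId B

@[simp] lemma tensorId_apply (A : F →L[ℂ] G) (f : H2 F) (n : ℕ) : tensorId A f n = A (f n) := rfl

@[simp] lemma rotation_apply (q : Circle) (f : H2 F) (n : ℕ) :
    rotation F q f n = (q : ℂ) ^ n • f n := rfl

@[simp] lemma shift_apply_zero (f : H2 F) : shift F f 0 = 0 := rfl

@[simp] lemma shift_apply_succ (f : H2 F) (n : ℕ) : shift F f (n + 1) = f n := rfl

/-- The Taylor series of an element of `H²(F)` converges at every point of the unit disc. -/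
lemma H2.summable_eval [CompleteSpace F] (f : H2 F) {z : ℂ} (hz : ‖z‖ < 1) :
    Summable fun n : ℕ => z ^ n • f n := by
  refine Summable.of_norm_bounded (g := fun n => ‖z‖ ^ n * ‖f‖)
    ((summable_geometric_of_lt_one (norm_nonneg z) hz).mul_right _) fun n => ?_
  rw [norm_smul, norm_pow]
  gcongr
  exact lp.norm_apply_le_norm (by norm_num) f n

lemma H2.eval_rotation (q : Circle) (f : H2 F) (z : ℂ) :
    H2.eval (rotation F q f) z = H2.eval f (q * z) := by
  simp only [H2.eval, rotation_apply, smul_smul, mul_pow, mul_comm]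

lemma H2.eval_tensorId [CompleteSpace F] (A : F →L[ℂ] G) (f : H2 F) {z : ℂ} (hz : ‖z‖ < 1) :
    H2.eval (tensorId A f) z = A (H2.eval f z) := by
  simp only [H2.eval, tensorId_apply]
  rw [A.map_tsum (H2.summable_eval f hz)]
  simp

lemma H2.eval_shift [CompleteSpace F] (f : H2 F) {z : ℂ} (hz : ‖z‖ < 1) :
    H2.eval (shift F f) z = z • H2.eval f z := by
  simp only [H2.eval]
  rw [(H2.summable_eval (shift F f) hz).tsum_eq_zero_add,
    ← (H2.summable_eval f hz).tsum_const_smul]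
  simp [pow_succ', smul_smul]

/-- `M_{A + zB}` is multiplication by the function `A + z B`. -/
lemma H2.eval_mulOp [CompleteSpace F] (A B : F →L[ℂ] F) (f : H2 F) {z : ℂ} (hz : ‖z‖ < 1) :
    H2.eval (mulOp A B f) z = (A + z • B) (H2.eval f z) := by
  have h : H2.eval (mulOp A B f) z =
      H2.eval (tensorId A f) z + H2.eval (shift F (tensorId B f)) z := by
    simp only [H2.eval]
    rw [← (H2.summable_eval _ hz).tsum_add (H2.summable_eval _ hz)]
    simp [mulOp]
  rw [h, H2.eval_shift _ hz, H2.eval_tensorId _ _ hz, H2.eval_tensorId _ _ hz]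
  simp

/-- The Hilbert space direct sum of two Hilbert spaces. -/
abbrev DSum (F : Type v) (G : Type w) : Type max v w := WithLp 2 (F × G)

/-- The block diagonal operator `A ⊕ B`. -/
def dsumMap {F' : Type u} [NormedAddCommGroup F'] [InnerProductSpace ℂ F']
    {G' : Type x} [NormedAddCommGroup G'] [InnerProductSpace ℂ G']
    (A : F →L[ℂ] F') (B : G →L[ℂ] G') : DSum F G →L[ℂ] DSum F' G' :=
  (WithLp.prodContinuousLinearEquiv 2 ℂ F' G').symm.toContinuousLinearMap ∘L
    (A.prodMap B) ∘L (WithLp.prodContinuousLinearEquiv 2 ℂ F G).toContinuousLinearMap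

/-- The orthogonal projection of `F ⊕ G` onto the first component `F ⊕ 0`. -/
def firstProj (F : Type v) [NormedAddCommGroup F] [InnerProductSpace ℂ F]
    (G : Type w) [NormedAddCommGroup G] [InnerProductSpace ℂ G] : DSum F G →L[ℂ] DSum F G :=
  dsumMap (ContinuousLinearMap.id ℂ F) 0

/-- The column operator `h ↦ A h ⊕ B h`. -/
def column {H : Type u} [NormedAddCommGroup H] [InnerProductSpace ℂ H]
    (A : H →L[ℂ] F) (B : H →L[ℂ] G) : H →L[ℂ] DSum F G :=
  (WithLp.prodContinuousLinearEquiv 2 ℂ F G).symm.toContinuousLinearMap ∘L (A.prod B)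

end Hardy

section Model

variable {H : Type u} [NormedAddCommGroup H] [InnerProductSpace ℂ H] [CompleteSpace H]

lemma sum_norm_defect {T : H →L[ℂ] H} (hT : ‖T‖ ≤ 1) (h : H) (N : ℕ) :
    ∑ n ∈ Finset.range N, ‖toDefect (adjoint T) ((adjoint T ^ n) h)‖ ^ 2 =
      ‖h‖ ^ 2 - ‖(adjoint T ^ N) h‖ ^ 2 := by
  induction N with
  | zero => simp
  | succ N ih =>
    have h1 : ‖toDefect (adjoint T) ((adjoint T ^ N) h)‖ ^ 2 =
        ‖(adjoint T ^ N) h‖ ^ 2 - ‖(adjoint T ^ (N + 1)) h‖ ^ 2 := by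
      rw [pow_succ' (adjoint T), mul_apply_eq_comp]
      exact norm_defect_sq (norm_adjoint_le hT) _
    rw [Finset.sum_range_succ, ih, h1]
    ring

lemma memℓp_observability {T : H →L[ℂ] H} (hT : ‖T‖ ≤ 1) (h : H) :
    Memℓp (fun n : ℕ => toDefect (adjoint T) ((adjoint T ^ n) h)) 2 := by
  refine memℓp_gen' (C := ‖h‖ ^ 2) fun s => ?_
  obtain ⟨N, hN⟩ := s.exists_nat_subset_range
  refine (Finset.sum_le_sum_of_subset_of_nonneg hN fun _ _ _ => by positivity).trans ?_
  have := sum_norm_defect hT h N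
  simp only [ENNReal.toReal_ofNat, Real.rpow_ofNat]
  rw [this]
  have : 0 ≤ ‖(adjoint T ^ N) h‖ ^ 2 := by positivity
  linarith

lemma norm_observability_le {T : H →L[ℂ] H} (hT : ‖T‖ ≤ 1) (h : H) :
    ‖(⟨fun n => toDefect (adjoint T) ((adjoint T ^ n) h), memℓp_observability hT h⟩ :
      H2 (defectSpace (adjoint T)))‖ ≤ ‖h‖ := by
  refine lp.norm_le_of_forall_sum_le (by norm_num) (norm_nonneg h) fun s => ?_
  obtain ⟨N, hN⟩ := s.exists_nat_subset_range
  simp only [ENNReal.toReal_ofNat, Real.rpow_ofNat]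
  refine (Finset.sum_le_sum_of_subset_of_nonneg hN fun _ _ _ => by positivity).trans ?_
  refine (sum_norm_defect hT h N).le.trans ?_
  have : 0 ≤ ‖(adjoint T ^ N) h‖ ^ 2 := by positivity
  linarith

/-- The operator `𝒪_{D_{T*}, T*} : H → H²(𝒟_{T*})`, `h ↦ ∑ zⁿ D_{T*} T*ⁿ h`. -/
def observability (T : H →L[ℂ] H) (hT : ‖T‖ ≤ 1) : H →L[ℂ] H2 (defectSpace (adjoint T)) :=
  LinearMap.mkContinuous
    { toFun h := ⟨fun n => toDefect (adjoint T) ((adjoint T ^ n) h), memℓp_observability hT h⟩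
      map_add' h k := by
        refine lp.ext (funext fun n => ?_)
        exact ((toDefect (adjoint T)).comp (adjoint T ^ n)).map_add h k
      map_smul' c h := by
        refine lp.ext (funext fun n => ?_)
        exact ((toDefect (adjoint T)).comp (adjoint T ^ n)).map_smul c h }
    1 fun h => by
      rw [one_mul]
      exact norm_observability_le hT h

lemma IsQContractivePair.norm_mul_le {q : Circle} {T₁ T₂ : H →L[ℂ] H}
    (hT : IsQContractivePair q T₁ T₂) : ‖T₁ * T₂‖ ≤ 1 :=
  (_root_.norm_mul_le _ _).trans (mul_le_one₀ hT.norm_le₁ (norm_nonneg _) hT.norm_le₂)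

variable {q : Circle} {T₁ T₂ : H →L[ℂ] H}

/-- The canonical `q`-commuting pair of unitaries `(W₁, W₂)` of a `q`-commuting pair of
contractions `(T₁, T₂)`, realised on a Hilbert space `𝒬` containing the closure of `Ran Q_{T*}`
through the isometric embedding `ι`, where `T = T₁ T₂`. (The inverse `W.symm` of a unitary `W` is
its adjoint, and each condition on vectors `Q_{T*} h` is one on the dense subspace `Ran Q_{T*}` of
its closure.) -/
structure CanonicalPair (hT : IsQContractivePair q T₁ T₂) (𝒬 : Type v) [NormedAddCommGroup 𝒬]
    [InnerProductSpace ℂ 𝒬] where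
  /-- the embedding of the closure of `Ran Q_{T*}` -/
  ι : closedRange (Qop (T₁ * T₂) hT.norm_mul_le) →ₗᵢ[ℂ] 𝒬
  /-- the unitary `W_D` -/
  WD : 𝒬 ≃ₗᵢ[ℂ] 𝒬
  W₁ : 𝒬 ≃ₗᵢ[ℂ] 𝒬
  W₂ : 𝒬 ≃ₗᵢ[ℂ] 𝒬
  /-- `W_D*` is an extension of the isometry `X* : Q_{T*} h ↦ Q_{T*} T* h` … -/
  WD_extends : ∀ h, WD.symm (ι (toClosedRange (Qop (T₁ * T₂) hT.norm_mul_le) h)) =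
    ι (toClosedRange (Qop (T₁ * T₂) hT.norm_mul_le) (adjoint (T₁ * T₂) h))
  /-- … and it is the minimal unitary extension. -/
  WD_minimal : (Submodule.span ℂ (Set.range fun p : ℕ × closedRange (Qop (T₁ * T₂)
    hT.norm_mul_le) => (WD ^ p.1) (ι p.2))).topologicalClosure = ⊤
  /-- `W₁*` extends the isometry `X₁* : Q_{T*} h ↦ Q_{T*} T₁* h`. -/
  W₁_extends : ∀ h, W₁.symm (ι (toClosedRange (Qop (T₁ * T₂) hT.norm_mul_le) h)) =
    ι (toClosedRange (Qop (T₁ * T₂) hT.norm_mul_le) (adjoint T₁ h))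
  /-- `W₂*` extends the isometry `X₂* : Q_{T*} h ↦ Q_{T*} T₂* h`. -/
  W₂_extends : ∀ h, W₂.symm (ι (toClosedRange (Qop (T₁ * T₂) hT.norm_mul_le) h)) =
    ι (toClosedRange (Qop (T₁ * T₂) hT.norm_mul_le) (adjoint T₂ h))
  /-- `W₁ W₂ = q W₂ W₁` -/
  qcomm : ∀ x, W₁ (W₂ x) = (q : ℂ) • W₂ (W₁ x)
  /-- `W₁* W₂* = q W_D*` -/
  prod_eq : ∀ x, W₁.symm (W₂.symm x) = (q : ℂ) • WD.symm x

/-- A special Andô tuple `(F_*, Λ_*, P_*, U_*)` for `(T₁*, T₂*)`, on the Hilbert space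
`F_* = 𝒟_{T₁*} ⊕ 𝒟_{T₂*} ⊕ E`, with `T = T₁ T₂`. -/
structure SpecialAndoTuple (T₁ T₂ : H →L[ℂ] H) (E : Type v) [NormedAddCommGroup E]
    [InnerProductSpace ℂ E] where
  /-- the isometry `Λ_*` on `𝒟_{T*}` -/
  Λ : defectSpace (adjoint (T₁ * T₂)) →ₗᵢ[ℂ]
    DSum (defectSpace (adjoint T₁)) (DSum (defectSpace (adjoint T₂)) E)
  /-- the unitary `U_*` -/
  U : DSum (defectSpace (adjoint T₁)) (DSum (defectSpace (adjoint T₂)) E) ≃ₗᵢ[ℂ]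
    DSum (defectSpace (adjoint T₁)) (DSum (defectSpace (adjoint T₂)) E)
  /-- `Λ_* D_{T*} h = D_{T₁*} T₂* h ⊕ D_{T₂*} h ⊕ 0` -/
  Λ_apply : ∀ h, Λ (toDefect (adjoint (T₁ * T₂)) h) =
    WithLp.toLp 2 (toDefect (adjoint T₁) (adjoint T₂ h),
      WithLp.toLp 2 (toDefect (adjoint T₂) h, 0))
  /-- `U_* (D_{T₁*} T₂* h ⊕ D_{T₂*} h ⊕ 0) = D_{T₁*} h ⊕ D_{T₂*} T₁* h ⊕ 0` -/
  U_apply : ∀ h, U (WithLp.toLp 2 (toDefect (adjoint T₁) (adjoint T₂ h),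
      WithLp.toLp 2 (toDefect (adjoint T₂) h, 0))) =
    WithLp.toLp 2 (toDefect (adjoint T₁) h,
      WithLp.toLp 2 (toDefect (adjoint T₂) (adjoint T₁ h), 0))

/-- The projection `P_*` of a special Andô tuple, onto the component `𝒟_{T₁*} ⊕ 0 ⊕ 0`. -/
def SpecialAndoTuple.P {E : Type v} [NormedAddCommGroup E] [InnerProductSpace ℂ E]
    (_A : SpecialAndoTuple T₁ T₂ E) :
    DSum (defectSpace (adjoint T₁)) (DSum (defectSpace (adjoint T₂)) E) →L[ℂ]
      DSum (defectSpace (adjoint T₁)) (DSum (defectSpace (adjoint T₂)) E) :=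
  firstProj (defectSpace (adjoint T₁)) (DSum (defectSpace (adjoint T₂)) E)

/-- A unitary as a bounded operator. -/
abbrev unitaryOp {F : Type v} [NormedAddCommGroup F] [InnerProductSpace ℂ F]
    (U : F ≃ₗᵢ[ℂ] F) : F →L[ℂ] F := U.toContinuousLinearEquiv.toContinuousLinearMap

/-- An Andô tuple `(F_*, Λ_*, P_*, U_*)` for `(T₁*, T₂*)`: an isometry `Λ_* : 𝒟_{T*} → F_*`,
a projection `P_*` and a unitary `U_*` on `F_*` that satisfy the two identities which the special
Andô tuples satisfy. -/
structure AndoTuple (q : Circle) (T₁ T₂ : H →L[ℂ] H) (F : Type v) [NormedAddCommGroup F]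
    [InnerProductSpace ℂ F] [CompleteSpace F] where
  Λ : defectSpace (adjoint (T₁ * T₂)) →ₗᵢ[ℂ] F
  P : F →L[ℂ] F
  U : F ≃ₗᵢ[ℂ] F
  isProj : IsStarProjection P
  /-- `Λ_* D_{T*} T₁* = P_*^⊥ U_* Λ_* D_{T*} + P_* U_* Λ_* D_{T*} T*` -/
  rel₁ : ∀ h, Λ (toDefect (adjoint (T₁ * T₂)) (adjoint T₁ h)) =
    (1 - P) (U (Λ (toDefect (adjoint (T₁ * T₂)) h))) +
      P (U (Λ (toDefect (adjoint (T₁ * T₂)) (adjoint (T₁ * T₂) h))))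
  /-- `Λ_* D_{T*} T₂* = U_*^* P_* Λ_* D_{T*} + q U_*^* P_*^⊥ Λ_* D_{T*} T*` -/
  rel₂ : ∀ h, Λ (toDefect (adjoint (T₁ * T₂)) (adjoint T₂ h)) =
    U.symm (P (Λ (toDefect (adjoint (T₁ * T₂)) h))) +
      (q : ℂ) • U.symm ((1 - P) (Λ (toDefect (adjoint (T₁ * T₂)) (adjoint (T₁ * T₂) h))))

section Operators

variable {F : Type v} [NormedAddCommGroup F] [InnerProductSpace ℂ F]
variable {𝒬 : Type w} [NormedAddCommGroup 𝒬] [InnerProductSpace ℂ 𝒬]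

/-- `V₁ᴰ = M_{U*(P^⊥ + zP)} R_q ⊕ W₁` on `H²(F) ⊕ 𝒬`. -/
def modelV₁ (q : Circle) (P : F →L[ℂ] F) (U : F ≃ₗᵢ[ℂ] F) (W₁ : 𝒬 ≃ₗᵢ[ℂ] 𝒬) :
    DSum (H2 F) 𝒬 →L[ℂ] DSum (H2 F) 𝒬 :=
  dsumMap (mulOp (unitaryOp U.symm * (1 - P)) (unitaryOp U.symm * P) * rotation F q)
    (unitaryOp W₁)

/-- `V₂ᴰ = R_{q̄} M_{(P + zP^⊥)U} ⊕ W₂` on `H²(F) ⊕ 𝒬`. -/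
def modelV₂ (q : Circle) (P : F →L[ℂ] F) (U : F ≃ₗᵢ[ℂ] F) (W₂ : 𝒬 ≃ₗᵢ[ℂ] 𝒬) :
    DSum (H2 F) 𝒬 →L[ℂ] DSum (H2 F) 𝒬 :=
  dsumMap (rotation F q⁻¹ * mulOp (P * unitaryOp U) ((1 - P) * unitaryOp U))
    (unitaryOp W₂)

/-- The Douglas embedding `Π_D h = 𝒪_{D_{T*}, T*} h ⊕ Q_{T*} h`, from `H` to
`H²(𝒟_{T*}) ⊕ 𝒬_{T*}`, where `T = T₁ T₂`. -/
def douglasEmbedding (hT : IsQContractivePair q T₁ T₂) (W : CanonicalPair hT 𝒬) :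
    H →L[ℂ] DSum (H2 (defectSpace (adjoint (T₁ * T₂)))) 𝒬 :=
  column (observability (T₁ * T₂) hT.norm_mul_le)
    (W.ι.toContinuousLinearMap ∘L toClosedRange (Qop (T₁ * T₂) hT.norm_mul_le))

/-- `Πᴰ = ((I ⊗ Λ) ⊕ I) Π_D`, from `H` to `H²(F) ⊕ 𝒬_{T*}`. -/
def modelEmbedding (hT : IsQContractivePair q T₁ T₂) (W : CanonicalPair hT 𝒬)
    (Λ : defectSpace (adjoint (T₁ * T₂)) →ₗᵢ[ℂ] F) : H →L[ℂ] DSum (H2 F) 𝒬 :=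
  dsumMap (tensorId Λ.toContinuousLinearMap) (ContinuousLinearMap.id ℂ 𝒬) ∘L
    douglasEmbedding hT W

/-- The coefficients of `Πᴰ h = (∑ zⁿ Λ D_{T*} T*ⁿ h) ⊕ Q_{T*} h`. -/
lemma modelEmbedding_fst (hT : IsQContractivePair q T₁ T₂) (W : CanonicalPair hT 𝒬)
    (Λ : defectSpace (adjoint (T₁ * T₂)) →ₗᵢ[ℂ] F) (h : H) (n : ℕ) :
    (modelEmbedding hT W Λ h).fst n =
      Λ (toDefect (adjoint (T₁ * T₂)) ((adjoint (T₁ * T₂) ^ n) h)) := rfl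

lemma modelEmbedding_snd (hT : IsQContractivePair q T₁ T₂) (W : CanonicalPair hT 𝒬)
    (Λ : defectSpace (adjoint (T₁ * T₂)) →ₗᵢ[ℂ] F) (h : H) :
    (modelEmbedding hT W Λ h).snd =
      W.ι (toClosedRange (Qop (T₁ * T₂) hT.norm_mul_le) h) := rfl

end Operators

section Lift

variable {K : Type w} [NormedAddCommGroup K] [InnerProductSpace ℂ K] [CompleteSpace K]

/-- `(Φ; V₁, V₂)` is a `q`-commuting isometric lift of `(T₁, T₂)`: `Φ : H → K` is an isometry,
`(V₁, V₂)` is a `q`-commuting pair of isometries on `K`, and `Vⱼ* Φ = Φ Tⱼ*`. -/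
structure IsIsometricLift (q : Circle) (T₁ T₂ : H →L[ℂ] H) (Φ : H →L[ℂ] K)
    (V₁ V₂ : K →L[ℂ] K) : Prop where
  isometry_embedding : Isometry Φ
  isometry₁ : Isometry V₁
  isometry₂ : Isometry V₂
  qcomm : V₁ * V₂ = (q : ℂ) • (V₂ * V₁)
  lift₁ : adjoint V₁ ∘L Φ = Φ ∘L adjoint T₁
  lift₂ : adjoint V₂ ∘L Φ = Φ ∘L adjoint T₂

/-- Minimality of a lift: `K` is the closed linear span of the vectors `V₁ᵐ V₂ⁿ Φ h`. -/
def IsMinimalLift (Φ : H →L[ℂ] K) (V₁ V₂ : K →L[ℂ] K) : Prop :=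
  (Submodule.span ℂ (Set.range fun p : ℕ × ℕ × H =>
    (V₁ ^ p.1) ((V₂ ^ p.2.1) (Φ p.2.2)))).topologicalClosure = ⊤

end Lift

end Model

end QDouglas

end

open QDouglas
universe u v w

/-! Write `T = T₁T₂`. On the Hardy space the symbols `U*(P^⊥ + zP)` and `(P + zP^⊥)U` multiply to
`z` in both orders, because `PP^⊥ = 0`. With the rotations inserted, one product of the model
operators is `M_z` and the other is `q̄ M_z`, which is `q`-commutation (`mul_modelV_fst`,
`mul_modelV_fst'`). Taking adjoints coefficientwise, the lifting relations become the two identities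
that define an Andô tuple (`isIsometricLift_model`). `Πᴰ` is isometric because `‖D_{T*} T*ⁿ h‖²`
telescopes to `‖h‖² - lim ‖T*ⁿ h‖² = ‖h‖² - ‖Q_{T*} h‖²`.

Existence of the data. The columns `D_{T₁*}T₂*h ⊕ D_{T₂*}h` and `D_{T₁*}h ⊕ D_{T₂*}T₁*h` both have
norm `‖D_{T*}h‖`, so a partial isometry carries one to the other; its Julia operator is a unitary on
two copies of the space, which gives a special Andô tuple. For the canonical pair, `T₁*` and `T₂*`
do not increase `‖Q_{T*}h‖` while `T*` preserves it, so both preserve it. They induce `q`-commuting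
isometries, which extend to the minimal unitary extension of their product by a comparison of Gram
matrices (`exists_unitary_pair`).

Converse. Take the Wold decomposition of the isometry `V = V₁V₂`. Its wandering space is `ker V* =
ker V₁* ⊕ V₁ ker V₂* = ker V₂* ⊕ V₂ ker V₁*`. The flip between these splittings is `U_*`, the
projection onto `V₂ ker V₁*` is `P_*`, and `D_{T*}h ↦ (I - VV*)Πh` is `Λ_*`. Both `Vⱼ` commute with
the projection onto the unitary part of `V`, and on the shift part they have the model form
(`shiftPart_apply₁`, `shiftPart_apply₂`). The space `𝒬` of the canonical pair embeds into the
unitary part, since the generating vectors have the same Gram matrix, and minimality of the lift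
makes this embedding onto the unitary part (`exists_model`). -/

noncomputable section

namespace QDouglas

/-! ### Isometries determined by norms or by Gram matrices. -/

section Extension

variable {E : Type*} [NormedAddCommGroup E] [InnerProductSpace ℂ E]
variable {F : Type*} [NormedAddCommGroup F] [InnerProductSpace ℂ F]

/-- A linear map with the same norms as a linear map of dense range factors through it by a linear
isometry. -/
theorem exists_linearIsometry_of_norm_eq [CompleteSpace F] {M : Type*} [AddCommGroup M]
    [Module ℂ M] (e : M →ₗ[ℂ] E) (f : M →ₗ[ℂ] F) (he : DenseRange e) (h : ∀ x, ‖f x‖ = ‖e x‖) :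
    ∃ L : E →ₗᵢ[ℂ] F, ∀ x, L (e x) = f x := by
  have hb : ∀ x, ‖f x‖ ≤ 1 * ‖e x‖ := fun x => by rw [one_mul, h]
  refine ⟨⟨(f.extendOfNorm e).toLinearMap, fun x => ?_⟩, LinearMap.extendOfNorm_eq he ⟨1, hb⟩⟩
  refine he.induction_on (p := fun x => ‖(f.extendOfNorm e) x‖ = ‖x‖) x
    (isClosed_eq (by fun_prop) (by fun_prop)) fun y => ?_
  rw [LinearMap.extendOfNorm_eq he ⟨1, hb⟩, h]

theorem norm_linearCombination_eq {ι : Type*} {v : ι → E} {w : ι → F}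
    (h : ∀ i j, inner ℂ (v i) (v j) = inner ℂ (w i) (w j)) (c : ι →₀ ℂ) :
    ‖Finsupp.linearCombination ℂ w c‖ = ‖Finsupp.linearCombination ℂ v c‖ := by
  have h2 : inner ℂ (Finsupp.linearCombination ℂ w c) (Finsupp.linearCombination ℂ w c) =
      inner ℂ (Finsupp.linearCombination ℂ v c) (Finsupp.linearCombination ℂ v c) := by
    simp only [Finsupp.linearCombination_apply, Finsupp.sum, sum_inner, inner_sum,
      inner_smul_left, inner_smul_right, h]
  rw [@norm_eq_sqrt_re_inner ℂ, @norm_eq_sqrt_re_inner ℂ, h2]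

/-- A total family of vectors is mapped by a linear isometry to any family with the same Gram
matrix. -/
theorem exists_linearIsometry_of_inner_eq [CompleteSpace F] {ι : Type*} (v : ι → E) (w : ι → F)
    (hv : (Submodule.span ℂ (Set.range v)).topologicalClosure = ⊤)
    (h : ∀ i j, inner ℂ (v i) (v j) = inner ℂ (w i) (w j)) :
    ∃ L : E →ₗᵢ[ℂ] F, ∀ i, L (v i) = w i := by
  obtain ⟨L, hL⟩ := exists_linearIsometry_of_norm_eq (Finsupp.linearCombination ℂ v)
    (Finsupp.linearCombination ℂ w) (by
      rw [DenseRange, ← LinearMap.coe_range, Finsupp.range_linearCombination]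
      exact Submodule.dense_iff_topologicalClosure_eq_top.2 hv)
    (norm_linearCombination_eq h)
  exact ⟨L, fun i => by simpa using hL (Finsupp.single i 1)⟩

/-- Continuous linear maps that agree on a total family are equal. -/
theorem clm_ext_of_total {ι : Type*} {v : ι → E}
    (hv : (Submodule.span ℂ (Set.range v)).topologicalClosure = ⊤) {A B : E →L[ℂ] F}
    (h : ∀ i, A (v i) = B (v i)) : A = B :=
  ContinuousLinearMap.ext_on (Submodule.dense_iff_topologicalClosure_eq_top.2 hv) <| by
    rintro _ ⟨i, rfl⟩
    exact h i

theorem inner_eq_of_norm_eq {M : Type*} [AddCommGroup M] [Module ℂ M] (e : M →ₗ[ℂ] E)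
    (f : M →ₗ[ℂ] F) (h : ∀ x, ‖f x‖ = ‖e x‖) (x y : M) :
    inner ℂ (f x) (f y) = inner ℂ (e x) (e y) := by
  simp only [inner_eq_sum_norm_sq_div_four, ← map_add, ← map_sub, ← map_smul, h]

theorem adjoint_pow [CompleteSpace E] (A : E →L[ℂ] E) (n : ℕ) :
    adjoint (A ^ n) = adjoint A ^ n := by
  simp only [← star_eq_adjoint, star_pow]

theorem adjoint_mul_self_of_isometry [CompleteSpace E] {V : E →L[ℂ] E} (hV : Isometry V) :
    adjoint V * V = 1 :=
  ContinuousLinearMap.norm_map_iff_adjoint_comp_self V |>.1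
    fun x => by simpa using hV.norm_map_of_map_zero (map_zero V) x

end Extension

/-! ### Unimodular scalars. -/

section Circle

variable (q : Circle)

theorem circle_inv_mul : ((q⁻¹ : Circle) : ℂ) * q = 1 := by
  rw [← Circle.coe_mul, inv_mul_cancel, Circle.coe_one]

theorem circle_mul_inv : (q : ℂ) * (q⁻¹ : Circle) = 1 := by
  rw [mul_comm, circle_inv_mul]

theorem circle_conj : (starRingEnd ℂ) (q : ℂ) = (q⁻¹ : Circle) := (Circle.coe_inv_eq_conj q).symm

end Circle

/-! ### Unitary dilation of a partial isometry. -/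

section Julia

variable {G : Type*} [NormedAddCommGroup G] [InnerProductSpace ℂ G] [CompleteSpace G]

theorem dsum_norm_sq {F G : Type*} [NormedAddCommGroup F] [NormedAddCommGroup G]
    (x : DSum F G) : ‖x‖ ^ 2 = ‖x.fst‖ ^ 2 + ‖x.snd‖ ^ 2 := WithLp.prod_norm_sq_eq_of_L2 x

theorem norm_add_sq_of_inner_eq_zero {x y : G} (h : inner ℂ x y = 0) :
    ‖x + y‖ ^ 2 = ‖x‖ ^ 2 + ‖y‖ ^ 2 := by
  rw [norm_add_sq (𝕜 := ℂ), h]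
  simp

/-- Pythagoras for the initial projection `W*W` of a partial isometry `W`. -/
theorem norm_sq_add_norm_sub_adjoint_sq {W : G →L[ℂ] G} (hW : ∀ x, W (adjoint W (W x)) = W x)
    (y : G) : ‖W y‖ ^ 2 + ‖y - adjoint W (W y)‖ ^ 2 = ‖y‖ ^ 2 := by
  have h1 : RCLike.re (inner ℂ y (adjoint W (W y))) = ‖W y‖ ^ 2 := by
    rw [adjoint_inner_right, inner_self_eq_norm_sq]
  have h2 : ‖adjoint W (W y)‖ ^ 2 = ‖W y‖ ^ 2 := by
    rw [← inner_self_eq_norm_sq (𝕜 := ℂ), adjoint_inner_left, hW, inner_self_eq_norm_sq]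
  rw [norm_sub_sq (𝕜 := ℂ), h1, h2]
  ring

/-- The Julia operator of a partial isometry `V`. -/
def julia (V : G →L[ℂ] G) : DSum G G →L[ℂ] DSum G G :=
  column (V ∘L WithLp.fstL 2 ℂ G G + (1 - V * adjoint V) ∘L WithLp.sndL 2 ℂ G G)
    ((1 - adjoint V * V) ∘L WithLp.fstL 2 ℂ G G - adjoint V ∘L WithLp.sndL 2 ℂ G G)

theorem julia_fst (V : G →L[ℂ] G) (x : DSum G G) :
    (julia V x).fst = V x.fst + (x.snd - V (adjoint V x.snd)) := rfl

theorem julia_snd (V : G →L[ℂ] G) (x : DSum G G) :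
    (julia V x).snd = (x.fst - adjoint V (V x.fst)) - adjoint V x.snd := rfl

theorem dsum_ext {F G : Type*} {x y : DSum F G} (h1 : x.fst = y.fst) (h2 : x.snd = y.snd) :
    x = y := WithLp.ofLp_injective _ (Prod.ext h1 h2)

/-- The Julia operator of a partial isometry is unitary. -/
theorem exists_julia_unitary (V : G →L[ℂ] G) (hV : ∀ x, V (adjoint V (V x)) = V x) :
    ∃ J : DSum G G ≃ₗᵢ[ℂ] DSum G G, ∀ x, J x = julia V x := by
  have hV' : ∀ x, adjoint V (V (adjoint V x)) = adjoint V x := fun x => by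
    refine ext_inner_left ℂ fun y => ?_
    rw [adjoint_inner_right, ← adjoint_inner_left, ← adjoint_inner_left, adjoint_adjoint, hV,
      adjoint_inner_right]
  have hnorm : ∀ x, ‖julia V x‖ = ‖x‖ := fun x => by
    rw [← sq_eq_sq₀ (norm_nonneg _) (norm_nonneg _), dsum_norm_sq, dsum_norm_sq, julia_fst,
      julia_snd]
    have e1 : inner ℂ (V x.fst) (x.snd - V (adjoint V x.snd)) = 0 := by
      rw [← adjoint_inner_right, map_sub, hV', sub_self, inner_zero_right]
    have e2 : inner ℂ (x.fst - adjoint V (V x.fst)) (-adjoint V x.snd) = 0 := by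
      rw [inner_neg_right, adjoint_inner_right, map_sub, hV, sub_self, inner_zero_left, neg_zero]
    have k1 := norm_sq_add_norm_sub_adjoint_sq hV x.fst
    have k2 := norm_sq_add_norm_sub_adjoint_sq (W := adjoint V) (by rwa [adjoint_adjoint]) x.snd
    rw [adjoint_adjoint] at k2
    rw [norm_add_sq_of_inner_eq_zero e1, sub_eq_add_neg (_ - _),
      norm_add_sq_of_inner_eq_zero e2, norm_neg]
    linarith
  -- The preimage of `y` is the adjoint of the Julia matrix applied to `y`.
  refine ⟨LinearIsometryEquiv.ofSurjective ⟨(julia V).toLinearMap, hnorm⟩ fun y =>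
    ⟨WithLp.toLp 2 (adjoint V y.fst + (y.snd - adjoint V (V y.snd)),
      (y.fst - V (adjoint V y.fst)) - V y.snd), ?_⟩, fun x => rfl⟩
  refine dsum_ext ((julia_fst V _).trans ?_) ((julia_snd V _).trans ?_)
  · simp [hV, hV']
  · simp [hV, hV']

/-- Two families of vectors of a Hilbert space `G` with equal norms are related by a unitary on
`G ⊕ G`. -/
theorem exists_unitary_dilation {M : Type*} [AddCommGroup M] [Module ℂ M] (e f : M →ₗ[ℂ] G)
    (h : ∀ x, ‖f x‖ = ‖e x‖) :
    ∃ J : DSum G G ≃ₗᵢ[ℂ] DSum G G, ∀ x, J (WithLp.toLp 2 (e x, 0)) = WithLp.toLp 2 (f x, 0) := by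
  set S := (LinearMap.range e).topologicalClosure with hS
  have hmem : ∀ x, e x ∈ S := fun x => Submodule.le_topologicalClosure _ ⟨x, rfl⟩
  obtain ⟨L, hL⟩ := exists_linearIsometry_of_norm_eq (e.codRestrict S hmem) f (by
    rw [DenseRange, Subtype.dense_iff, ← Set.range_comp]
    exact fun x hx => hx) h
  -- `L` is extended by zero off the closed range of `e`. Then `V*V` is the projection onto that
  -- range, so the second Julia component `(I - V*V) e x` vanishes.
  set V : G →L[ℂ] G := L.toContinuousLinearMap ∘L S.orthogonalProjectionOnto with hVdef
  have hV : ∀ x, V x = L (S.orthogonalProjectionOnto x) := fun x => rfl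
  have hVe : ∀ x, V (e x) = f x := fun x => by
    rw [← hL x, hV]
    exact congrArg L (Submodule.orthogonalProjectionOnto_mem_subspace_eq_self (⟨e x, hmem x⟩ : S))
  have hVV : ∀ x, adjoint V (V x) = S.starProjection x := fun x => ext_inner_left ℂ fun y => by
    rw [adjoint_inner_right, hV, hV, L.inner_map_map, Submodule.coe_inner]
    change inner ℂ (S.starProjection y) (S.starProjection x) = _
    rw [Submodule.inner_starProjection_left_eq_right, Submodule.starProjection_eq_self_iff.2]
    exact Submodule.starProjection_apply_mem _ _
  obtain ⟨J, hJ⟩ := exists_julia_unitary V fun x => by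
    rw [hVV, hV, hV]
    exact congrArg L (Submodule.orthogonalProjectionOnto_mem_subspace_eq_self
      (S.orthogonalProjectionOnto x))
  refine ⟨J, fun x => ?_⟩
  have h3 : adjoint V (f x) = e x := by
    rw [← hVe, hVV, Submodule.starProjection_eq_self_iff]
    exact hmem x
  rw [hJ]
  refine dsum_ext ((julia_fst V _).trans ?_) ((julia_snd V _).trans ?_)
  · simp [hVe]
  · simp [hVe, h3]

end Julia

/-! ### Operators on the vector-valued Hardy space. -/

section Hardy

variable {F : Type*} [NormedAddCommGroup F] [InnerProductSpace ℂ F]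
variable {G : Type*} [NormedAddCommGroup G] [InnerProductSpace ℂ G]

theorem H2.ext {f g : H2 F} (h : ∀ n, f n = g n) : f = g := lp.ext (funext h)

theorem H2.norm_sq (f : H2 F) : HasSum (fun n => ‖f n‖ ^ 2) (‖f‖ ^ 2) := by
  simpa using lp.hasSum_norm (p := 2) (by norm_num) f

theorem summable_backshift (f : H2 F) : Summable fun n => ‖f (n + 1)‖ ^ (2 : ℝ≥0∞).toReal :=
  (summable_nat_add_iff 1).2 (lp.hasSum_norm (p := 2) (by norm_num) f).summable

/-- The backward shift on `H²(F)`. -/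
def backshift (F : Type*) [NormedAddCommGroup F] [InnerProductSpace ℂ F] : H2 F →L[ℂ] H2 F :=
  LinearMap.mkContinuous
    { toFun f := ⟨fun n => f (n + 1), memℓp_gen (summable_backshift f)⟩
      map_add' _ _ := rfl
      map_smul' _ _ := rfl }
    1 fun f => by
      rw [one_mul, ← sq_le_sq₀ (norm_nonneg _) (norm_nonneg _)]
      have h1 := H2.norm_sq (⟨fun n => f (n + 1), memℓp_gen (summable_backshift f)⟩ : H2 F)
      have h2 := (hasSum_nat_add_iff' 1).2 (H2.norm_sq f)
      have h3 := h1.unique h2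
      refine h3.le.trans ?_
      simp

@[simp] theorem backshift_apply (f : H2 F) (n : ℕ) : backshift F f n = f (n + 1) := rfl

theorem adjoint_shift [CompleteSpace F] : adjoint (shift F) = backshift F := by
  symm
  rw [eq_adjoint_iff]
  intro f g
  refine (lp.hasSum_inner (𝕜 := ℂ) (backshift F f) g).unique ?_
  have h := (hasSum_nat_add_iff' 1).2 (lp.hasSum_inner (𝕜 := ℂ) f (shift F g))
  simpa using h

theorem adjoint_tensorId [CompleteSpace F] [CompleteSpace G] (A : F →L[ℂ] G) :
    adjoint (tensorId A) = tensorId (adjoint A) := by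
  symm
  rw [eq_adjoint_iff]
  intro f g
  refine (lp.hasSum_inner (𝕜 := ℂ) (tensorId (adjoint A) f) g).unique ?_
  simpa [adjoint_inner_left] using lp.hasSum_inner (𝕜 := ℂ) f (tensorId A g)

theorem adjoint_rotation [CompleteSpace F] (q : Circle) :
    adjoint (rotation F q) = rotation F q⁻¹ := by
  symm
  rw [eq_adjoint_iff]
  intro f g
  refine (lp.hasSum_inner (𝕜 := ℂ) (rotation F q⁻¹ f) g).unique ?_
  convert lp.hasSum_inner (𝕜 := ℂ) f (rotation F q g) using 2 with n
  simp only [rotation_apply, inner_smul_left, inner_smul_right, map_pow, circle_conj, inv_inv]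

theorem tensorId_mul (A B : F →L[ℂ] F) : tensorId A * tensorId B = tensorId (A * B) := rfl

theorem tensorId_add (A B : F →L[ℂ] F) : tensorId A + tensorId B = tensorId (A + B) := rfl

theorem tensorId_one : tensorId (1 : F →L[ℂ] F) = 1 := rfl

theorem tensorId_zero : tensorId (0 : F →L[ℂ] F) = 0 := rfl

theorem tensorId_mul_shift (A : F →L[ℂ] F) : tensorId A * shift F = shift F * tensorId A := by
  refine ContinuousLinearMap.ext fun f => H2.ext fun n => ?_
  cases n with
  | zero => exact map_zero A
  | succ n => rfl

theorem rotation_mul_shift (q : Circle) :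
    rotation F q * shift F = (q : ℂ) • (shift F * rotation F q) := by
  refine ContinuousLinearMap.ext fun f => H2.ext fun n => ?_
  cases n with
  | zero => exact (smul_zero _).trans (smul_zero _).symm
  | succ n =>
    change (q : ℂ) ^ (n + 1) • f n = (q : ℂ) • (q : ℂ) ^ n • f n
    rw [pow_succ', mul_smul]

theorem rotation_mul_inv (q : Circle) : rotation F q * rotation F q⁻¹ = 1 := by
  refine ContinuousLinearMap.ext fun f => H2.ext fun n => ?_
  change (q : ℂ) ^ n • ((q⁻¹ : Circle) : ℂ) ^ n • f n = f n
  rw [smul_smul, ← mul_pow, circle_mul_inv, one_pow, one_smul]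

theorem rotation_inv_mul (q : Circle) : rotation F q⁻¹ * rotation F q = 1 := by
  simpa using rotation_mul_inv (F := F) q⁻¹

theorem norm_rotation (q : Circle) (f : H2 F) : ‖rotation F q f‖ = ‖f‖ := by
  rw [← sq_eq_sq₀ (norm_nonneg _) (norm_nonneg _)]
  refine (H2.norm_sq (rotation F q f)).unique ?_
  simpa only [rotation_apply, norm_smul, norm_pow, Circle.norm_coe, one_pow, one_mul]
    using H2.norm_sq f

theorem adjoint_mulOp_apply [CompleteSpace F] (A B : F →L[ℂ] F) (f : H2 F) (n : ℕ) :
    adjoint (mulOp A B) f n = adjoint A (f n) + adjoint B (f (n + 1)) := by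
  rw [mulOp, map_add, ← star_eq_adjoint (shift F * tensorId B), star_mul, star_eq_adjoint,
    star_eq_adjoint, adjoint_shift, adjoint_tensorId, adjoint_tensorId]
  rfl

theorem mulOp_apply_zero (A B : F →L[ℂ] F) (f : H2 F) : mulOp A B f 0 = A (f 0) :=
  add_zero (A (f 0))

theorem mulOp_apply_succ (A B : F →L[ℂ] F) (f : H2 F) (n : ℕ) :
    mulOp A B f (n + 1) = A (f (n + 1)) + B (f n) := rfl

theorem mulOp_mul (A B C D : F →L[ℂ] F) : mulOp A B * mulOp C D =
    tensorId (A * C) + shift F * tensorId (A * D + B * C) +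
      shift F * shift F * tensorId (B * D) := by
  have h1 : tensorId A * (shift F * tensorId D) = shift F * tensorId (A * D) := by
    rw [← mul_assoc, tensorId_mul_shift, mul_assoc, tensorId_mul]
  have h2 : shift F * tensorId B * (shift F * tensorId D) =
      shift F * shift F * tensorId (B * D) := by
    rw [mul_assoc, ← mul_assoc (tensorId B), tensorId_mul_shift, mul_assoc, tensorId_mul,
      mul_assoc]
  rw [mulOp, mulOp, add_mul, mul_add, mul_add, h1, h2, ← tensorId_add, mul_add, tensorId_mul,
    mul_assoc (shift F) (tensorId B), tensorId_mul]
  abel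

/-- The hypotheses are the vanishing or normalisation of the Fourier coefficients of `φ*φ` for `φ(z)
= A + zB`: they say that `φ(z)` is an isometry for `|z| = 1`. -/
theorem norm_mulOp [CompleteSpace F] {A B : F →L[ℂ] F}
    (h1 : adjoint A * A + adjoint B * B = 1) (h2 : adjoint A * B = 0) (f : H2 F) :
    ‖mulOp A B f‖ = ‖f‖ := by
  refine (ContinuousLinearMap.norm_map_iff_adjoint_comp_self _).2 ?_ f
  have h3 : adjoint B * A = 0 := by
    have := congrArg star h2
    simpa only [star_mul, star_eq_adjoint, adjoint_adjoint, star_zero] using this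
  refine ContinuousLinearMap.ext fun f => H2.ext fun n => ?_
  change adjoint (mulOp A B) (mulOp A B f) n = f n
  have k1 : ∀ x, adjoint A (A x) + adjoint B (B x) = x := fun x => congr($h1 x)
  have k2 : ∀ x, adjoint A (B x) = 0 := fun x => congr($h2 x)
  have k3 : ∀ x, adjoint B (A x) = 0 := fun x => congr($h3 x)
  rw [adjoint_mulOp_apply, mulOp_apply_succ]
  cases n with
  | zero => rw [mulOp_apply_zero, map_add, k3, zero_add, k1]
  | succ n => rw [mulOp_apply_succ, map_add, map_add, k2, k3, zero_add, add_zero, k1]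

/-- The vectors `zⁿ a` are total in `H²(F)`. -/
theorem single_mem_induction {S : Submodule ℂ (H2 F)} (hS : IsClosed (S : Set (H2 F)))
    (h : ∀ n (a : F), lp.single 2 n a ∈ S) (f : H2 F) : f ∈ S :=
  hS.mem_of_tendsto (lp.hasSum_single (by norm_num) f)
    (Eventually.of_forall fun s => S.sum_mem fun n _ => h n (f n))

end Hardy

/-! ### Block diagonal operators. -/

section DSum

variable {F : Type*} [NormedAddCommGroup F] [InnerProductSpace ℂ F]
variable {G : Type*} [NormedAddCommGroup G] [InnerProductSpace ℂ G]

theorem adjoint_dsumMap [CompleteSpace F] [CompleteSpace G] (A : F →L[ℂ] F) (B : G →L[ℂ] G) :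
    adjoint (dsumMap A B) = dsumMap (adjoint A) (adjoint B) := by
  symm
  rw [eq_adjoint_iff]
  intro x y
  change inner ℂ (adjoint A x.fst) y.fst + inner ℂ (adjoint B x.snd) y.snd =
    inner ℂ x.fst (A y.fst) + inner ℂ x.snd (B y.snd)
  rw [adjoint_inner_left, adjoint_inner_left]

theorem isometry_dsumMap {A : F →L[ℂ] F} {B : G →L[ℂ] G} (hA : ∀ x, ‖A x‖ = ‖x‖)
    (hB : ∀ x, ‖B x‖ = ‖x‖) : Isometry (dsumMap A B) := by
  refine AddMonoidHomClass.isometry_of_norm _ fun x => ?_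
  rw [← sq_eq_sq₀ (norm_nonneg _) (norm_nonneg _), dsum_norm_sq, dsum_norm_sq]
  change ‖A x.fst‖ ^ 2 + ‖B x.snd‖ ^ 2 = _
  rw [hA, hB]

theorem dsumMap_mul (A A' : F →L[ℂ] F) (B B' : G →L[ℂ] G) :
    dsumMap A B * dsumMap A' B' = dsumMap (A * A') (B * B') := rfl

theorem dsumMap_smul (c : ℂ) (A : F →L[ℂ] F) (B : G →L[ℂ] G) :
    c • dsumMap A B = dsumMap (c • A) (c • B) := rfl

theorem adjoint_unitaryOp [CompleteSpace F] (U : F ≃ₗᵢ[ℂ] F) :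
    adjoint (unitaryOp U) = unitaryOp U.symm := by
  symm
  rw [eq_adjoint_iff]
  intro x y
  exact U.symm.inner_map_eq_flip x y

end DSum

/-! ### The model operators: `q`-commutation, isometry, adjoints. -/

section Model

variable {F : Type*} [NormedAddCommGroup F] [InnerProductSpace ℂ F]
variable {𝒬 : Type*} [NormedAddCommGroup 𝒬] [InnerProductSpace ℂ 𝒬]

theorem unitaryOp_mul_symm (U : F ≃ₗᵢ[ℂ] F) : unitaryOp U * unitaryOp U.symm = 1 :=
  ContinuousLinearMap.ext U.apply_symm_apply

theorem unitaryOp_symm_mul (U : F ≃ₗᵢ[ℂ] F) : unitaryOp U.symm * unitaryOp U = 1 :=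
  ContinuousLinearMap.ext U.symm_apply_apply

variable {P : F →L[ℂ] F}

/-- The two rotations meet in the middle and cancel; what remains is `U*(P^⊥ + zP)(P + zP^⊥)U = z`.
-/
theorem mul_modelV_fst (q : Circle) (hP : P * P = P) (U : F ≃ₗᵢ[ℂ] F) :
    mulOp (unitaryOp U.symm * (1 - P)) (unitaryOp U.symm * P) * rotation F q *
      (rotation F q⁻¹ * mulOp (P * unitaryOp U) ((1 - P) * unitaryOp U)) = shift F := by
  have h0 : P * (1 - P) = 0 := by rw [mul_sub, mul_one, hP, sub_self]
  have h0' : (1 - P) * P = 0 := by rw [sub_mul, one_mul, hP, sub_self]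
  have h0'' : (1 - P) * (1 - P) = 1 - P := by rw [sub_mul, one_mul, h0, sub_zero]
  rw [mul_assoc, ← mul_assoc (rotation F q), rotation_mul_inv, one_mul, mulOp_mul]
  have e1 : unitaryOp U.symm * (1 - P) * (P * unitaryOp U) = 0 := by
    rw [mul_assoc, ← mul_assoc (1 - P), h0', zero_mul, mul_zero]
  have e2 : unitaryOp U.symm * P * ((1 - P) * unitaryOp U) = 0 := by
    rw [mul_assoc, ← mul_assoc P, h0, zero_mul, mul_zero]
  have e3 : unitaryOp U.symm * (1 - P) * ((1 - P) * unitaryOp U) +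
      unitaryOp U.symm * P * (P * unitaryOp U) = 1 := by
    rw [mul_assoc, ← mul_assoc (1 - P), h0'', mul_assoc, ← mul_assoc P, hP, ← mul_add, ← add_mul,
      sub_add_cancel, one_mul, unitaryOp_symm_mul]
  rw [e1, e2, e3, tensorId_zero, tensorId_one, mul_one, mul_zero, add_zero, zero_add]

/-- In this order the symbols again multiply to `z`, but the rotations stand outside, and `R_{q̄}
M_z R_q = q̄ M_z`. The factor `q̄` is the whole source of the `q`-commutation. -/
theorem mul_modelV_fst' (q : Circle) (hP : P * P = P) (U : F ≃ₗᵢ[ℂ] F) :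
    rotation F q⁻¹ * mulOp (P * unitaryOp U) ((1 - P) * unitaryOp U) *
      (mulOp (unitaryOp U.symm * (1 - P)) (unitaryOp U.symm * P) * rotation F q) =
        ((q⁻¹ : Circle) : ℂ) • shift F := by
  have h0 : P * (1 - P) = 0 := by rw [mul_sub, mul_one, hP, sub_self]
  have h0' : (1 - P) * P = 0 := by rw [sub_mul, one_mul, hP, sub_self]
  have h0'' : (1 - P) * (1 - P) = 1 - P := by rw [sub_mul, one_mul, h0, sub_zero]
  have e0 : ∀ A B : F →L[ℂ] F, A * unitaryOp U * (unitaryOp U.symm * B) = A * B := fun A B => by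
    rw [mul_assoc, ← mul_assoc (unitaryOp U), unitaryOp_mul_symm, one_mul]
  rw [mul_assoc, ← mul_assoc (mulOp _ _), mulOp_mul]
  simp only [e0]
  rw [h0, hP, h0', h0'', add_sub_cancel, tensorId_zero, tensorId_one, mul_one, mul_zero, add_zero,
    zero_add, ← mul_assoc, rotation_mul_shift, smul_mul_assoc, mul_assoc, rotation_inv_mul,
    mul_one]

theorem modelV_qcomm (q : Circle) (hP : P * P = P) (U : F ≃ₗᵢ[ℂ] F) (W₁ W₂ : 𝒬 ≃ₗᵢ[ℂ] 𝒬)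
    (hW : ∀ x, W₁ (W₂ x) = (q : ℂ) • W₂ (W₁ x)) :
    modelV₁ q P U W₁ * modelV₂ q P U W₂ = (q : ℂ) • (modelV₂ q P U W₂ * modelV₁ q P U W₁) := by
  rw [modelV₁, modelV₂, dsumMap_mul, dsumMap_mul, dsumMap_smul, mul_modelV_fst q hP,
    mul_modelV_fst' q hP, smul_smul, circle_mul_inv, one_smul]
  congr 1
  exact ContinuousLinearMap.ext hW

variable [CompleteSpace F]

theorem adjoint_mul_unitaryOp (U : F ≃ₗᵢ[ℂ] F) (A : F →L[ℂ] F) :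
    adjoint (A * unitaryOp U) = unitaryOp U.symm * adjoint A := by
  rw [← star_eq_adjoint, star_mul, star_eq_adjoint, star_eq_adjoint, adjoint_unitaryOp]

theorem adjoint_unitaryOp_symm_mul (U : F ≃ₗᵢ[ℂ] F) (A : F →L[ℂ] F) :
    adjoint (unitaryOp U.symm * A) = adjoint A * unitaryOp U := by
  rw [← star_eq_adjoint, star_mul, star_eq_adjoint, star_eq_adjoint, adjoint_unitaryOp,
    LinearIsometryEquiv.symm_symm]

theorem isometry_modelV₁ (q : Circle) (hP : IsStarProjection P) (U : F ≃ₗᵢ[ℂ] F)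
    (W₁ : 𝒬 ≃ₗᵢ[ℂ] 𝒬) : Isometry (modelV₁ q P U W₁) := by
  have hP1 : P * P = P := hP.isIdempotentElem
  have hP2 : adjoint P = P := hP.isSelfAdjoint
  have h1 : adjoint (1 - P) = 1 - P := hP.one_sub.isSelfAdjoint
  have h2 : (1 - P) * (1 - P) = 1 - P := hP.one_sub.isIdempotentElem
  have e0 : ∀ A B : F →L[ℂ] F, A * unitaryOp U * (unitaryOp U.symm * B) = A * B := fun A B => by
    rw [mul_assoc, ← mul_assoc (unitaryOp U), unitaryOp_mul_symm, one_mul]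
  refine isometry_dsumMap (fun f => ?_) W₁.norm_map
  rw [mul_apply_eq_comp, norm_mulOp, norm_rotation]
  · rw [adjoint_unitaryOp_symm_mul, adjoint_unitaryOp_symm_mul, hP2, h1, e0, e0, h2, hP1,
      sub_add_cancel]
  · rw [adjoint_unitaryOp_symm_mul, h1, e0, sub_mul, one_mul, hP1, sub_self]

theorem isometry_modelV₂ (q : Circle) (hP : IsStarProjection P) (U : F ≃ₗᵢ[ℂ] F)
    (W₂ : 𝒬 ≃ₗᵢ[ℂ] 𝒬) : Isometry (modelV₂ q P U W₂) := by
  have hP1 : P * P = P := hP.isIdempotentElem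
  have hP2 : adjoint P = P := hP.isSelfAdjoint
  have h1 : adjoint (1 - P) = 1 - P := hP.one_sub.isSelfAdjoint
  have h2 : (1 - P) * (1 - P) = 1 - P := hP.one_sub.isIdempotentElem
  have e0 : ∀ A B : F →L[ℂ] F, unitaryOp U.symm * A * (B * unitaryOp U) =
      unitaryOp U.symm * (A * B) * unitaryOp U := fun A B => by simp only [mul_assoc]
  refine isometry_dsumMap (fun f => ?_) W₂.norm_map
  rw [mul_apply_eq_comp, norm_rotation, norm_mulOp]
  · rw [adjoint_mul_unitaryOp, adjoint_mul_unitaryOp, hP2, h1, e0, e0, h2, hP1, ← add_mul,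
      ← mul_add, add_sub_cancel, mul_one, unitaryOp_symm_mul]
  · rw [adjoint_mul_unitaryOp, hP2, e0, mul_sub, mul_one, hP1, sub_self, mul_zero, zero_mul]

variable [CompleteSpace 𝒬]

theorem adjoint_modelV₁_fst (q : Circle) (hP : IsStarProjection P) (U : F ≃ₗᵢ[ℂ] F)
    (W₁ : 𝒬 ≃ₗᵢ[ℂ] 𝒬) (x : DSum (H2 F) 𝒬) (n : ℕ) : (adjoint (modelV₁ q P U W₁) x).fst n =
      ((q⁻¹ : Circle) : ℂ) ^ n • ((1 - P) (U (x.fst n)) + P (U (x.fst (n + 1)))) := by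
  rw [modelV₁, adjoint_dsumMap, ← star_eq_adjoint (_ * _), star_mul, star_eq_adjoint,
    star_eq_adjoint, adjoint_rotation]
  change ((q⁻¹ : Circle) : ℂ) ^ n • adjoint (mulOp _ _) x.fst n = _
  rw [adjoint_mulOp_apply, adjoint_unitaryOp_symm_mul, adjoint_unitaryOp_symm_mul,
    show adjoint P = P from hP.isSelfAdjoint,
    show adjoint (1 - P) = 1 - P from hP.one_sub.isSelfAdjoint]
  rfl

theorem adjoint_modelV₁_snd (q : Circle) (U : F ≃ₗᵢ[ℂ] F)
    (W₁ : 𝒬 ≃ₗᵢ[ℂ] 𝒬) (x : DSum (H2 F) 𝒬) :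
    (adjoint (modelV₁ q P U W₁) x).snd = W₁.symm x.snd := by
  rw [modelV₁, adjoint_dsumMap, adjoint_unitaryOp]
  rfl

theorem adjoint_modelV₂_fst (q : Circle) (hP : IsStarProjection P) (U : F ≃ₗᵢ[ℂ] F)
    (W₂ : 𝒬 ≃ₗᵢ[ℂ] 𝒬) (x : DSum (H2 F) 𝒬) (n : ℕ) : (adjoint (modelV₂ q P U W₂) x).fst n =
      U.symm (P ((q : ℂ) ^ n • x.fst n)) +
        U.symm ((1 - P) ((q : ℂ) ^ (n + 1) • x.fst (n + 1))) := by
  rw [modelV₂, adjoint_dsumMap, ← star_eq_adjoint (_ * _), star_mul, star_eq_adjoint,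
    star_eq_adjoint, adjoint_rotation, inv_inv]
  change adjoint (mulOp _ _) (rotation F q x.fst) n = _
  rw [adjoint_mulOp_apply, adjoint_mul_unitaryOp, adjoint_mul_unitaryOp,
    show adjoint P = P from hP.isSelfAdjoint,
    show adjoint (1 - P) = 1 - P from hP.one_sub.isSelfAdjoint]
  rfl

theorem adjoint_modelV₂_snd (q : Circle) (U : F ≃ₗᵢ[ℂ] F)
    (W₂ : 𝒬 ≃ₗᵢ[ℂ] 𝒬) (x : DSum (H2 F) 𝒬) :
    (adjoint (modelV₂ q P U W₂) x).snd = W₂.symm x.snd := by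
  rw [modelV₂, adjoint_dsumMap, adjoint_unitaryOp]
  rfl

end Model

/-! ### Adjoints of a `q`-commuting pair, and norms of defect vectors and of `Q_{T*} h`. -/

section Contractions

variable {H : Type u} [NormedAddCommGroup H] [InnerProductSpace ℂ H] [CompleteSpace H]

section Pair

variable {q : Circle} {T₁ T₂ : H →L[ℂ] H}

theorem adjoint_mul (A B : H →L[ℂ] H) : adjoint (A * B) = adjoint B * adjoint A := by
  simp only [← star_eq_adjoint, star_mul]

theorem adjoint_circle_smul (q : Circle) (A : H →L[ℂ] H) :
    adjoint ((q : ℂ) • A) = ((q⁻¹ : Circle) : ℂ) • adjoint A := by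
  rw [map_smulₛₗ, circle_conj]

theorem mul_adjoint_of_qcomm (h : T₁ * T₂ = (q : ℂ) • (T₂ * T₁)) :
    adjoint T₁ * adjoint T₂ = (q : ℂ) • adjoint (T₁ * T₂) := by
  rw [h, adjoint_circle_smul, smul_smul, circle_mul_inv, one_smul, adjoint_mul]

theorem adjoint₁_apply_adjoint_mul (h : T₁ * T₂ = (q : ℂ) • (T₂ * T₁)) :
    adjoint T₁ * adjoint (T₁ * T₂) = (q : ℂ) • (adjoint (T₁ * T₂) * adjoint T₁) := by
  rw [adjoint_mul T₁, ← mul_assoc, mul_adjoint_of_qcomm h, smul_mul_assoc, adjoint_mul T₁]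

theorem adjoint₂_apply_adjoint_mul (h : T₁ * T₂ = (q : ℂ) • (T₂ * T₁)) :
    adjoint (T₁ * T₂) * adjoint T₂ = (q : ℂ) • (adjoint T₂ * adjoint (T₁ * T₂)) := by
  nth_rewrite 1 [adjoint_mul T₁]
  rw [mul_assoc, mul_adjoint_of_qcomm h, mul_smul_comm]

theorem mul_pow_of_qcomm {c : ℂ} {A B : H →L[ℂ] H} (h : A * B = c • (B * A)) (n : ℕ) :
    A * B ^ n = c ^ n • (B ^ n * A) := by
  induction n with
  | zero => simp
  | succ n ih =>
    rw [pow_succ, ← mul_assoc, ih, smul_mul_assoc, mul_assoc, h, mul_smul_comm, smul_smul,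
      mul_assoc, pow_succ]

theorem pow_mul_of_qcomm {c : ℂ} {A B : H →L[ℂ] H} (h : B * A = c • (A * B)) (n : ℕ) :
    B ^ n * A = c ^ n • (A * B ^ n) := by
  induction n with
  | zero => simp
  | succ n ih =>
    rw [pow_succ', mul_assoc, ih, mul_smul_comm, ← mul_assoc, h, smul_mul_assoc, smul_smul,
      mul_assoc, ← pow_succ]

end Pair

section Defect

variable {A : H →L[ℂ] H}

theorem norm_toDefect_sq (hA : ‖A‖ ≤ 1) (h : H) : ‖toDefect A h‖ ^ 2 = ‖h‖ ^ 2 - ‖A h‖ ^ 2 :=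
  norm_defect_sq hA h

theorem denseRange_toClosedRange (B : H →L[ℂ] H) : DenseRange (toClosedRange B) := by
  rw [DenseRange, Subtype.dense_iff, ← Set.range_comp]
  exact fun x hx => hx

/-- This holds because `⟨Tⁿ T*ⁿ h, h⟩ = ‖T*ⁿ h‖²`. Estimates on `Q_{T*}` are thereby reduced to
estimates on the powers of `T*`. -/
theorem norm_Qop_sq {T : H →L[ℂ] H} (hT : ‖T‖ ≤ 1) (h : H) :
    Tendsto (fun n : ℕ => ‖(adjoint T ^ n) h‖ ^ 2) atTop (𝓝 (‖Qop T hT h‖ ^ 2)) := by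
  have h1 : Tendsto (fun n : ℕ => ((‖(adjoint T ^ n) h‖ ^ 2 : ℝ) : ℂ)) atTop
      (𝓝 ((‖Qop T hT h‖ ^ 2 : ℝ) : ℂ)) := by
    rw [Qop, norm_sqrt_sq (asymptoticLimit_nonneg hT)]
    refine ((tendsto_asymptoticLimit hT h).inner (𝕜 := ℂ) (tendsto_const_nhds (x := h))).congr
      fun n => ?_
    rw [mul_apply_eq_comp, ← adjoint_inner_right, adjoint_pow, inner_self_eq_norm_sq_to_K]
    norm_cast
  exact_mod_cast (Complex.continuous_re.tendsto _).comp h1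

/-- The partial sums of the coefficients telescope to `‖h‖² - ‖T*ᴺ h‖²`. -/
theorem norm_observability_sq {T : H →L[ℂ] H} (hT : ‖T‖ ≤ 1) (h : H) :
    ‖observability T hT h‖ ^ 2 + ‖Qop T hT h‖ ^ 2 = ‖h‖ ^ 2 := by
  have h1 := (H2.norm_sq (observability T hT h)).tendsto_sum_nat
  have h2 : Tendsto (fun N : ℕ => ‖h‖ ^ 2 - ‖(adjoint T ^ N) h‖ ^ 2) atTop
      (𝓝 (‖observability T hT h‖ ^ 2)) := h1.congr fun N => sum_norm_defect hT h N
  have h3 := tendsto_nhds_unique h2 (tendsto_const_nhds.sub (norm_Qop_sq hT h))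
  linarith

end Defect

/-! ### The model of an Andô tuple is an isometric lift. -/

section ModelLift

variable {q : Circle} {T₁ T₂ : H →L[ℂ] H}
variable {𝒬 : Type*} [NormedAddCommGroup 𝒬] [InnerProductSpace ℂ 𝒬] [CompleteSpace 𝒬]
variable {F : Type*} [NormedAddCommGroup F] [InnerProductSpace ℂ F] [CompleteSpace F]

theorem isometry_modelEmbedding (hT : IsQContractivePair q T₁ T₂) (W : CanonicalPair hT 𝒬)
    (Λ : defectSpace (adjoint (T₁ * T₂)) →ₗᵢ[ℂ] F) : Isometry (modelEmbedding hT W Λ) := by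
  refine AddMonoidHomClass.isometry_of_norm _ fun h => ?_
  rw [← sq_eq_sq₀ (norm_nonneg _) (norm_nonneg _), dsum_norm_sq, modelEmbedding_snd, W.ι.norm_map,
    ← norm_observability_sq hT.norm_mul_le h]
  refine congrArg₂ _ ((H2.norm_sq _).unique ?_) rfl
  simp only [modelEmbedding_fst, Λ.norm_map]
  exact H2.norm_sq (observability (T₁ * T₂) hT.norm_mul_le h)

/-- The model built from an Andô tuple is a `q`-commuting isometric lift. -/
theorem isIsometricLift_model (hT : IsQContractivePair q T₁ T₂) (W : CanonicalPair hT 𝒬)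
    (A : AndoTuple q T₁ T₂ F) : IsIsometricLift q T₁ T₂ (modelEmbedding hT W A.Λ)
      (modelV₁ q A.P A.U W.W₁) (modelV₂ q A.P A.U W.W₂) where
  isometry_embedding := isometry_modelEmbedding hT W A.Λ
  isometry₁ := isometry_modelV₁ q A.isProj A.U W.W₁
  isometry₂ := isometry_modelV₂ q A.isProj A.U W.W₂
  qcomm := modelV_qcomm q A.isProj.isIdempotentElem A.U W.W₁ W.W₂ W.qcomm
  lift₁ := by
    refine ContinuousLinearMap.ext fun h => dsum_ext (H2.ext fun n => ?_) ?_
    · rw [comp_apply, comp_apply, adjoint_modelV₁_fst q A.isProj, modelEmbedding_fst,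
        modelEmbedding_fst, modelEmbedding_fst, pow_succ', mul_apply_eq_comp, ← A.rel₁]
      -- Moving `T₁*` past `T*ⁿ` produces `qⁿ`, which cancels the `q̄ⁿ` that the adjoint of the
      -- rotation puts on the `n`-th coefficient.
      have h1 := congr($(mul_pow_of_qcomm (adjoint₁_apply_adjoint_mul hT.qcomm) n) h)
      rw [mul_apply_eq_comp] at h1
      rw [h1, smul_apply, map_smul, map_smul, smul_smul, ← mul_pow, circle_inv_mul, one_pow,
        one_smul]
      rfl
    · rw [comp_apply, comp_apply, adjoint_modelV₁_snd, modelEmbedding_snd, modelEmbedding_snd,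
        W.W₁_extends]
  lift₂ := by
    refine ContinuousLinearMap.ext fun h => dsum_ext (H2.ext fun n => ?_) ?_
    · rw [comp_apply, comp_apply, adjoint_modelV₂_fst q A.isProj, modelEmbedding_fst,
        modelEmbedding_fst, modelEmbedding_fst]
      -- Here the rotation contributes `qⁿ` to the model side, and `T*ⁿ T₂* = qⁿ T₂* T*ⁿ` supplies
      -- the same factor on the other. The extra `q` on the coefficient `n + 1` is the one in
      -- `rel₂`.
      have h1 := congr($(pow_mul_of_qcomm (adjoint₂_apply_adjoint_mul hT.qcomm) n) h)
      rw [mul_apply_eq_comp, smul_apply, mul_apply_eq_comp] at h1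
      have h2 : A.Λ (toDefect (adjoint (T₁ * T₂)) ((adjoint (T₁ * T₂) ^ n) (adjoint T₂ h))) =
          (q : ℂ) ^ n • A.Λ (toDefect (adjoint (T₁ * T₂))
            (adjoint T₂ ((adjoint (T₁ * T₂) ^ n) h))) := by
        rw [h1, map_smul (toDefect _), map_smul A.Λ]
      rw [h2, A.rel₂, pow_succ', pow_succ' (adjoint (T₁ * T₂)), mul_apply_eq_comp, map_smul,
        map_smul, map_smul, map_smul, smul_add, smul_smul, mul_comm (q : ℂ)]
    · rw [comp_apply, comp_apply, adjoint_modelV₂_snd, modelEmbedding_snd, modelEmbedding_snd,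
        W.W₂_extends]

end ModelLift

/-! ### Existence of special Andô tuples, and the Andô identities for them. -/

section Special

variable {q : Circle} {T₁ T₂ : H →L[ℂ] H}

/-- The column `h ↦ D_{T₁*} T₂* h ⊕ D_{T₂*} h`. -/
def defectColumn (T₁ T₂ : H →L[ℂ] H) :
    H →L[ℂ] DSum (defectSpace (adjoint T₁)) (defectSpace (adjoint T₂)) :=
  column (toDefect (adjoint T₁) ∘L adjoint T₂) (toDefect (adjoint T₂))

/-- The column `h ↦ D_{T₁*} h ⊕ D_{T₂*} T₁* h`. -/
def defectColumn' (T₁ T₂ : H →L[ℂ] H) :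
    H →L[ℂ] DSum (defectSpace (adjoint T₁)) (defectSpace (adjoint T₂)) :=
  column (toDefect (adjoint T₁)) (toDefect (adjoint T₂) ∘L adjoint T₁)

theorem defectColumn_apply (h : H) : defectColumn T₁ T₂ h =
    WithLp.toLp 2 (toDefect (adjoint T₁) (adjoint T₂ h), toDefect (adjoint T₂) h) := rfl

theorem defectColumn'_apply (h : H) : defectColumn' T₁ T₂ h =
    WithLp.toLp 2 (toDefect (adjoint T₁) h, toDefect (adjoint T₂) (adjoint T₁ h)) := rfl

theorem norm_adjoint_adjoint (hT : IsQContractivePair q T₁ T₂) (h : H) :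
    ‖adjoint T₁ (adjoint T₂ h)‖ = ‖adjoint (T₁ * T₂) h‖ := by
  have := congr(‖$(mul_adjoint_of_qcomm hT.qcomm) h‖)
  rwa [mul_apply_eq_comp, smul_apply, norm_smul, Circle.norm_coe, one_mul] at this

/-- The squared norms telescope to `‖h‖² - ‖T₁*T₂*h‖²`, and `T₁*T₂* = qT*` with `|q| = 1`. -/
theorem norm_defectColumn (hT : IsQContractivePair q T₁ T₂) (h : H) :
    ‖defectColumn T₁ T₂ h‖ = ‖toDefect (adjoint (T₁ * T₂)) h‖ := by
  rw [← sq_eq_sq₀ (norm_nonneg _) (norm_nonneg _), dsum_norm_sq]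
  change ‖toDefect (adjoint T₁) (adjoint T₂ h)‖ ^ 2 + ‖toDefect (adjoint T₂) h‖ ^ 2 = _
  rw [norm_toDefect_sq (norm_adjoint_le hT.norm_le₁), norm_toDefect_sq (norm_adjoint_le hT.norm_le₂),
    norm_toDefect_sq (norm_adjoint_le hT.norm_mul_le), norm_adjoint_adjoint hT]
  ring

theorem norm_defectColumn' (hT : IsQContractivePair q T₁ T₂) (h : H) :
    ‖defectColumn' T₁ T₂ h‖ = ‖toDefect (adjoint (T₁ * T₂)) h‖ := by
  rw [← sq_eq_sq₀ (norm_nonneg _) (norm_nonneg _), dsum_norm_sq]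
  change ‖toDefect (adjoint T₁) h‖ ^ 2 + ‖toDefect (adjoint T₂) (adjoint T₁ h)‖ ^ 2 = _
  rw [norm_toDefect_sq (norm_adjoint_le hT.norm_le₁), norm_toDefect_sq (norm_adjoint_le hT.norm_le₂),
    norm_toDefect_sq (norm_adjoint_le hT.norm_mul_le), adjoint_mul, mul_apply_eq_comp]
  ring

section Columns

variable {A : Type*} [NormedAddCommGroup A] [InnerProductSpace ℂ A]
variable {B : Type*} [NormedAddCommGroup B] [InnerProductSpace ℂ B]

/-- The inclusion of `A ⊕ B` in `A ⊕ B ⊕ E`. -/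
def inclDSum (A : Type*) [NormedAddCommGroup A] [InnerProductSpace ℂ A] (B : Type*)
    [NormedAddCommGroup B] [InnerProductSpace ℂ B] (E : Type*) [NormedAddCommGroup E]
    [InnerProductSpace ℂ E] : DSum A B →ₗᵢ[ℂ] DSum A (DSum B E) where
  toLinearMap := (column (WithLp.fstL 2 ℂ A B) (column (WithLp.sndL 2 ℂ A B) 0)).toLinearMap
  norm_map' x := by
    have h1 : ‖(WithLp.toLp 2 (x.snd, 0) : DSum B E)‖ ^ 2 = ‖x.snd‖ ^ 2 + ‖(0 : E)‖ ^ 2 :=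
      dsum_norm_sq _
    have h2 : ‖(WithLp.toLp 2 (x.fst, WithLp.toLp 2 (x.snd, 0)) : DSum A (DSum B E))‖ ^ 2 =
      ‖x.fst‖ ^ 2 + ‖(WithLp.toLp 2 (x.snd, 0) : DSum B E)‖ ^ 2 := dsum_norm_sq _
    rw [← sq_eq_sq₀ (norm_nonneg _) (norm_nonneg _), dsum_norm_sq x]
    refine h2.trans ?_
    rw [h1, norm_zero]
    ring

theorem inclDSum_toLp {E : Type*} [NormedAddCommGroup E] [InnerProductSpace ℂ E] (a : A) (b : B) :
    inclDSum A B E (WithLp.toLp 2 (a, b)) = WithLp.toLp 2 (a, WithLp.toLp 2 (b, 0)) := rfl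

/-- The dilation on `(A ⊕ B) ⊕ (A ⊕ B)` is reassociated, so that the second copy of `A ⊕ B` plays
the role of the extra summand `E`. -/
theorem exists_unitary_extension [CompleteSpace A] [CompleteSpace B] {M : Type*} [AddCommGroup M]
    [Module ℂ M] (e f : M →ₗ[ℂ] DSum A B) (h : ∀ x, ‖f x‖ = ‖e x‖) :
    ∃ U : DSum A (DSum B (DSum A B)) ≃ₗᵢ[ℂ] DSum A (DSum B (DSum A B)),
      ∀ x, U (inclDSum A B (DSum A B) (e x)) = inclDSum A B (DSum A B) (f x) := by
  obtain ⟨J, hJ⟩ := exists_unitary_dilation e f h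
  let a := LinearIsometryEquiv.withLpProdAssoc 2 ℂ A B (DSum A B)
  have ha : ∀ x : DSum A B, a (WithLp.toLp 2 (x, 0)) = inclDSum A B (DSum A B) x := fun x => rfl
  refine ⟨a.symm.trans (J.trans a), fun x => ?_⟩
  rw [← ha, ← ha, LinearIsometryEquiv.trans_apply, LinearIsometryEquiv.symm_apply_apply,
    LinearIsometryEquiv.trans_apply, hJ]

theorem isStarProjection_firstProj [CompleteSpace A] [CompleteSpace B] :
    IsStarProjection (firstProj A B) := by
  refine ⟨?_, ?_⟩
  · exact ContinuousLinearMap.ext fun x => dsum_ext rfl rfl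
  · rw [IsSelfAdjoint, star_eq_adjoint, firstProj, adjoint_dsumMap, map_zero, adjoint_id]

theorem firstProj_toLp (a : A) (b : B) :
    firstProj A B (WithLp.toLp 2 (a, b)) = WithLp.toLp 2 (a, 0) := rfl

theorem one_sub_firstProj_toLp (a : A) (b : B) :
    (1 - firstProj A B) (WithLp.toLp 2 (a, b)) = WithLp.toLp 2 (0, b) :=
  dsum_ext (sub_self a) (sub_zero b)

theorem toLp_add_toLp (a : A) (b : B) :
    (WithLp.toLp 2 (0, b) : DSum A B) + WithLp.toLp 2 (a, 0) = WithLp.toLp 2 (a, b) :=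
  dsum_ext (zero_add a) (add_zero b)

theorem toLp_smul_zero (c : ℂ) (a : A) :
    (WithLp.toLp 2 (c • a, 0) : DSum A B) = c • WithLp.toLp 2 (a, 0) :=
  dsum_ext rfl (smul_zero c).symm

theorem toLp_add_smul_toLp (c : ℂ) (a : A) (b : B) :
    (WithLp.toLp 2 (a, 0) : DSum A B) + c • WithLp.toLp 2 (0, b) = WithLp.toLp 2 (a, c • b) :=
  dsum_ext ((congrArg (a + ·) (smul_zero c)).trans (add_zero a)) (zero_add (c • b))

theorem eq_symm_add_smul_symm (U : A ≃ₗᵢ[ℂ] A) (c : ℂ) {x y z : A} (h : U x = y + c • z) :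
    x = U.symm y + c • U.symm z := by
  rw [← map_smul, ← map_add, ← h, U.symm_apply_apply]

end Columns

/-- Both columns have the norm of `D_{T*} h`. This makes `Λ_*` well defined and isometric, and it
makes the prescription for `U_*` isometric where it is given. -/
theorem exists_specialAndoTuple (hT : IsQContractivePair q T₁ T₂) :
    Nonempty (SpecialAndoTuple T₁ T₂
      (DSum (defectSpace (adjoint T₁)) (defectSpace (adjoint T₂)))) := by
  obtain ⟨U, hU⟩ := exists_unitary_extension (defectColumn T₁ T₂).toLinearMap
    (defectColumn' T₁ T₂).toLinearMap
    fun h => (norm_defectColumn' hT h).trans (norm_defectColumn hT h).symm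
  obtain ⟨L, hL⟩ := exists_linearIsometry_of_norm_eq
    (toDefect (adjoint (T₁ * T₂))).toLinearMap (defectColumn T₁ T₂).toLinearMap
    (denseRange_toClosedRange _) (norm_defectColumn hT)
  refine ⟨⟨(inclDSum _ _ _).comp L, U, fun h => ?_, fun h => ?_⟩⟩
  · rw [← inclDSum_toLp, ← defectColumn_apply]
    exact congrArg (inclDSum _ _ _) (hL h)
  · rw [← inclDSum_toLp, ← defectColumn_apply, ← inclDSum_toLp, ← defectColumn'_apply]
    exact hU h

variable {E : Type w} [NormedAddCommGroup E] [InnerProductSpace ℂ E] [CompleteSpace E]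

/-- `U_*Λ_*D_{T*}h = D_{T₁*}h ⊕ D_{T₂*}T₁*h ⊕ 0`. The second entry is already that of
`Λ_*D_{T*}T₁*h`; the first entry is obtained from `T*h`, since `T* = T₂*T₁*`. -/
theorem SpecialAndoTuple.rel₁ (A : SpecialAndoTuple T₁ T₂ E) (h : H) :
    A.Λ (toDefect (adjoint (T₁ * T₂)) (adjoint T₁ h)) =
      (1 - A.P) (A.U (A.Λ (toDefect (adjoint (T₁ * T₂)) h))) +
        A.P (A.U (A.Λ (toDefect (adjoint (T₁ * T₂)) (adjoint (T₁ * T₂) h)))) := by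
  have h1 : adjoint (T₁ * T₂) h = adjoint T₂ (adjoint T₁ h) := by rw [adjoint_mul]; rfl
  have h2 := (congrArg A.U (A.Λ_apply h)).trans (A.U_apply h)
  have h3 := (congrArg A.U (A.Λ_apply (adjoint (T₁ * T₂) h))).trans
    (A.U_apply (adjoint (T₁ * T₂) h))
  rw [h2, h3, A.Λ_apply (adjoint T₁ h), SpecialAndoTuple.P, firstProj_toLp,
    one_sub_firstProj_toLp, toLp_add_toLp, h1]

/-- Apply `U_*` to the left side: it becomes `D_{T₁*}T₂*h ⊕ D_{T₂*}T₁*T₂*h ⊕ 0`, and `T₁*T₂* = qT*`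
turns the second entry into `q` times that of `Λ_*D_{T*}T*h`. -/
theorem SpecialAndoTuple.rel₂ (hT : IsQContractivePair q T₁ T₂) (A : SpecialAndoTuple T₁ T₂ E)
    (h : H) : A.Λ (toDefect (adjoint (T₁ * T₂)) (adjoint T₂ h)) =
      A.U.symm (A.P (A.Λ (toDefect (adjoint (T₁ * T₂)) h))) +
        (q : ℂ) • A.U.symm ((1 - A.P)
          (A.Λ (toDefect (adjoint (T₁ * T₂)) (adjoint (T₁ * T₂) h)))) := by
  have h1 := congr($(mul_adjoint_of_qcomm hT.qcomm) h)
  rw [mul_apply_eq_comp, smul_apply] at h1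
  have h2 := (congrArg A.U (A.Λ_apply (adjoint T₂ h))).trans (A.U_apply (adjoint T₂ h))
  rw [h1, map_smul] at h2
  refine eq_symm_add_smul_symm A.U (q : ℂ) (h2.trans ?_)
  rw [A.Λ_apply h, A.Λ_apply (adjoint (T₁ * T₂) h), SpecialAndoTuple.P, firstProj_toLp,
    one_sub_firstProj_toLp, toLp_add_smul_toLp]
  exact congrArg (fun y => WithLp.toLp 2 (_, y)) (toLp_smul_zero _ _)

/-- A special Andô tuple is an Andô tuple. -/
def SpecialAndoTuple.toAndoTuple (hT : IsQContractivePair q T₁ T₂)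
    (A : SpecialAndoTuple T₁ T₂ E) : AndoTuple q T₁ T₂
      (DSum (defectSpace (adjoint T₁)) (DSum (defectSpace (adjoint T₂)) E)) where
  Λ := A.Λ
  P := A.P
  U := A.U
  isProj := isStarProjection_firstProj
  rel₁ := A.rel₁
  rel₂ := A.rel₂ hT

end Special

end Contractions

/-! ### The minimal unitary extension of an isometry. -/

section UnitaryExtension

variable {R : Type u} [NormedAddCommGroup R] [InnerProductSpace ℂ R] [CompleteSpace R]

/-- The projection `I - Y Y*` onto `ker Y*`, for an isometry `Y`. -/
def coProj (Y : R →ₗᵢ[ℂ] R) : R →L[ℂ] (adjoint Y.toContinuousLinearMap).ker :=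
  (1 - Y.toContinuousLinearMap * adjoint Y.toContinuousLinearMap).codRestrict _ fun x => by
    have h1 : adjoint Y.toContinuousLinearMap (Y.toContinuousLinearMap
        (adjoint Y.toContinuousLinearMap x)) = adjoint Y.toContinuousLinearMap x :=
      congr($(adjoint_mul_self_of_isometry (V := Y.toContinuousLinearMap) Y.isometry)
        (adjoint Y.toContinuousLinearMap x))
    rw [LinearMap.mem_ker]
    change adjoint Y.toContinuousLinearMap (x - Y.toContinuousLinearMap
      (adjoint Y.toContinuousLinearMap x)) = 0
    rw [map_sub, h1, sub_self]

theorem coe_coProj (Y : R →ₗᵢ[ℂ] R) (x : R) :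
    (coProj Y x : R) = x - Y (adjoint Y.toContinuousLinearMap x) := rfl

theorem adjoint_apply_isometry (Y : R →ₗᵢ[ℂ] R) (x : R) :
    adjoint Y.toContinuousLinearMap (Y x) = x :=
  congr($(adjoint_mul_self_of_isometry (V := Y.toContinuousLinearMap) Y.isometry) x)

theorem norm_coProj_sq (Y : R →ₗᵢ[ℂ] R) (x : R) :
    ‖adjoint Y.toContinuousLinearMap x‖ ^ 2 + ‖coProj Y x‖ ^ 2 = ‖x‖ ^ 2 := by
  have := norm_sq_add_norm_sub_adjoint_sq (W := adjoint Y.toContinuousLinearMap) (fun y => by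
    rw [adjoint_adjoint]
    exact adjoint_apply_isometry Y _) x
  rw [adjoint_adjoint] at this
  exact this

/-- The minimal unitary extension `(x, e) ↦ (Y* x, (x - Y Y* x, e₀, e₁, …))` of `Y*`. -/
def unitaryExtension (Y : R →ₗᵢ[ℂ] R) :
    DSum R (H2 (adjoint Y.toContinuousLinearMap).ker) →L[ℂ]
      DSum R (H2 (adjoint Y.toContinuousLinearMap).ker) :=
  column (adjoint Y.toContinuousLinearMap ∘L WithLp.fstL 2 ℂ _ _)
    (shift _ ∘L WithLp.sndL 2 ℂ _ _ +
      lp.singleContinuousLinearMap ℂ (fun _ : ℕ => (adjoint Y.toContinuousLinearMap).ker) 2 0 ∘L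
        coProj Y ∘L WithLp.fstL 2 ℂ _ _)

variable (Y : R →ₗᵢ[ℂ] R) (x : DSum R (H2 (adjoint Y.toContinuousLinearMap).ker))

theorem unitaryExtension_fst :
    (unitaryExtension Y x).fst = adjoint Y.toContinuousLinearMap x.fst := rfl

theorem unitaryExtension_snd :
    (unitaryExtension Y x).snd = shift _ x.snd + lp.single 2 0 (coProj Y x.fst) := rfl

theorem unitaryExtension_snd_zero : (unitaryExtension Y x).snd 0 = coProj Y x.fst := by
  rw [unitaryExtension_snd, lp.coeFn_add, Pi.add_apply, shift_apply_zero, zero_add,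
    lp.single_apply_self]

theorem unitaryExtension_snd_succ (n : ℕ) : (unitaryExtension Y x).snd (n + 1) = x.snd n := by
  rw [unitaryExtension_snd, lp.coeFn_add, Pi.add_apply, shift_apply_succ,
    lp.single_apply_ne _ _ _ n.succ_ne_zero, add_zero]

/-- The vector `x` of the first summand is split into `Y*x` and `(I - YY*)x`, whose squared norms
add up to `‖x‖²`; the rest is shifted. -/
theorem norm_unitaryExtension : ‖unitaryExtension Y x‖ = ‖x‖ := by
  rw [← sq_eq_sq₀ (norm_nonneg _) (norm_nonneg _), dsum_norm_sq, dsum_norm_sq x,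
    ← norm_coProj_sq Y x.fst, unitaryExtension_fst, add_assoc]
  congr 1
  have h := (hasSum_nat_add_iff' 1).2 (H2.norm_sq (unitaryExtension Y x).snd)
  simp only [unitaryExtension_snd_succ, Finset.sum_range_one, unitaryExtension_snd_zero] at h
  rw [(H2.norm_sq x.snd).unique h]
  ring

theorem unitaryExtension_surjective : Function.Surjective (unitaryExtension Y) := fun y => by
  have hk : adjoint Y.toContinuousLinearMap (y.snd 0) = 0 := (y.snd 0).2
  have hp : adjoint Y.toContinuousLinearMap (Y y.fst + y.snd 0) = y.fst := by
    rw [map_add, adjoint_apply_isometry, hk, add_zero]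
  -- The inverse applies `Y`, takes the coefficient of index `0` back from `ker Y*` into `R`, and
  -- shifts the others down.
  refine ⟨WithLp.toLp 2 (Y y.fst + y.snd 0, backshift _ y.snd), dsum_ext hp (H2.ext fun n => ?_)⟩
  cases n with
  | zero =>
    rw [unitaryExtension_snd_zero]
    refine Subtype.ext ?_
    rw [coe_coProj]
    change (Y y.fst + y.snd 0 : R) - Y (adjoint Y.toContinuousLinearMap (Y y.fst + y.snd 0)) =
      y.snd 0
    rw [hp, add_sub_cancel_left]
  | succ n =>
    rw [unitaryExtension_snd_succ]
    rfl

/-- The unitary `unitaryExtension Y`. -/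
def unitaryExtensionEquiv :
    DSum R (H2 (adjoint Y.toContinuousLinearMap).ker) ≃ₗᵢ[ℂ]
      DSum R (H2 (adjoint Y.toContinuousLinearMap).ker) :=
  LinearIsometryEquiv.ofSurjective ⟨(unitaryExtension Y).toLinearMap, norm_unitaryExtension Y⟩
    (unitaryExtension_surjective Y)

/-- The inclusion of the first summand. -/
def inl (R : Type*) [NormedAddCommGroup R] [InnerProductSpace ℂ R] (G : Type*)
    [NormedAddCommGroup G] [InnerProductSpace ℂ G] : R →ₗᵢ[ℂ] DSum R G where
  toLinearMap := (column (ContinuousLinearMap.id ℂ R) 0).toLinearMap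
  norm_map' x := by
    have h : ‖(WithLp.toLp 2 (x, 0) : DSum R G)‖ ^ 2 = ‖x‖ ^ 2 + ‖(0 : G)‖ ^ 2 := dsum_norm_sq _
    rw [norm_zero, zero_pow two_ne_zero, add_zero] at h
    exact (sq_eq_sq₀ (norm_nonneg _) (norm_nonneg _)).1 h

theorem unitaryExtensionEquiv_inl (r : R) :
    unitaryExtensionEquiv Y (inl R _ (Y r)) = inl R _ r := by
  refine dsum_ext (adjoint_apply_isometry Y r) (H2.ext fun n => ?_)
  cases n with
  | zero =>
    refine (unitaryExtension_snd_zero Y _).trans (Subtype.ext ?_)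
    change Y r - Y (adjoint Y.toContinuousLinearMap (Y r)) = 0
    rw [adjoint_apply_isometry, sub_self]
  | succ n => exact unitaryExtension_snd_succ Y _ n

/-- Minimality rests on this: every `zⁿ a` is reached from `R`. The exponent is `n + 1` because the
first application only moves `a ∈ ker Y*` out of `R` into the coefficient of index `0`. -/
theorem unitaryExtensionEquiv_pow_inl (a : (adjoint Y.toContinuousLinearMap).ker) (n : ℕ) :
    (unitaryExtensionEquiv Y ^ (n + 1)) (inl R _ (a : R)) =
      WithLp.toLp 2 (0, lp.single 2 n a) := by
  induction n with
  | zero =>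
    rw [zero_add, pow_one]
    refine dsum_ext a.2 ((unitaryExtension_snd Y _).trans ?_)
    have h : coProj Y (a : R) = a := Subtype.ext <| by
      rw [coe_coProj, show adjoint Y.toContinuousLinearMap (a : R) = 0 from a.2, map_zero, sub_zero]
    change shift _ 0 + lp.single 2 0 (coProj Y (a : R)) = lp.single 2 0 a
    rw [map_zero, zero_add, h]
  | succ n ih =>
    rw [pow_succ', LinearIsometryEquiv.coe_mul, Function.comp_apply, ih]
    refine dsum_ext (map_zero (adjoint Y.toContinuousLinearMap)) (H2.ext fun m => ?_)
    cases m with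
    | zero =>
      refine (unitaryExtension_snd_zero Y _).trans ?_
      refine (map_zero (coProj Y)).trans ?_
      exact (lp.single_apply_ne (E := fun _ : ℕ => (adjoint Y.toContinuousLinearMap).ker) 2 (n + 1)
        a (j := 0) n.succ_ne_zero.symm).symm
    | succ m =>
      refine (unitaryExtension_snd_succ Y _ m).trans ?_
      change (lp.single 2 n a : H2 (adjoint Y.toContinuousLinearMap).ker) m =
        (lp.single 2 (n + 1) a : H2 (adjoint Y.toContinuousLinearMap).ker) (m + 1)
      by_cases h : m = n
      · rw [h, lp.single_apply_self, lp.single_apply_self]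
      · rw [lp.single_apply_ne _ _ _ h, lp.single_apply_ne _ _ _ (by omega)]

theorem unitaryExtensionEquiv_total : (Submodule.span ℂ (Set.range fun p : ℕ × R =>
    (unitaryExtensionEquiv Y ^ p.1) (inl R _ p.2))).topologicalClosure = ⊤ := by
  set S := (Submodule.span ℂ (Set.range fun p : ℕ × R =>
    (unitaryExtensionEquiv Y ^ p.1) (inl R _ p.2))).topologicalClosure with hS
  have hmem : ∀ n r, (unitaryExtensionEquiv Y ^ n) (inl R _ r) ∈ S := fun n r =>
    Submodule.le_topologicalClosure _ (Submodule.subset_span ⟨(n, r), rfl⟩)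
  have hclosed : IsClosed (S : Set (DSum R (H2 (adjoint Y.toContinuousLinearMap).ker))) :=
    Submodule.isClosed_topologicalClosure _
  let j : H2 (adjoint Y.toContinuousLinearMap).ker →L[ℂ]
    DSum R (H2 (adjoint Y.toContinuousLinearMap).ker) := column 0 (ContinuousLinearMap.id ℂ _)
  refine eq_top_iff.2 fun x _ => ?_
  have h1 : ∀ f, j f ∈ S := fun f => single_mem_induction (S := S.comap j.toLinearMap)
    (hclosed.preimage j.continuous) (fun n a => by
      rw [Submodule.mem_comap]
      have h2 := hmem (n + 1) a
      rw [unitaryExtensionEquiv_pow_inl] at h2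
      exact h2) f
  have h2 : x = inl R _ x.fst + j x.snd := dsum_ext (add_zero _).symm (zero_add _).symm
  rw [h2]
  exact S.add_mem (hmem 0 _) (h1 _)

theorem exists_minimal_unitary_extension (Y : R →ₗᵢ[ℂ] R) :
    ∃ (𝒬 : Type u) (_ : NormedAddCommGroup 𝒬) (_ : InnerProductSpace ℂ 𝒬)
      (_ : CompleteSpace 𝒬) (ι : R →ₗᵢ[ℂ] 𝒬) (W : 𝒬 ≃ₗᵢ[ℂ] 𝒬), (∀ r, W (ι (Y r)) = ι r) ∧
      (Submodule.span ℂ (Set.range fun p : ℕ × R => (W ^ p.1) (ι p.2))).topologicalClosure = ⊤ :=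
  ⟨DSum R (H2 (adjoint Y.toContinuousLinearMap).ker), inferInstance, inferInstance, inferInstance,
    inl R _, unitaryExtensionEquiv Y, unitaryExtensionEquiv_inl Y, unitaryExtensionEquiv_total Y⟩

end UnitaryExtension

/-! ### Gram matrices of orbits. -/

section Gram

variable {K : Type*} [NormedAddCommGroup K] [InnerProductSpace ℂ K]

theorem pow_apply_of_apply {M : Type*} {X : K → K} {Y : M → M} {j : M → K}
    (h : ∀ r, X (j (Y r)) = j r) (n : ℕ) (r : M) : X^[n] (j (Y^[n] r)) = j r := by
  induction n generalizing r with
  | zero => rfl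
  | succ n ih => rw [Function.iterate_succ_apply, Function.iterate_succ_apply', h, ih]

/-- Since `j r = Xᵐ j(Yᵐ r)` and `j s = Xⁿ j(Yⁿ s)`, both vectors are images under `Xⁿ⁺ᵐ`, which
preserves inner products. Hence the Gram matrix of the whole orbit is determined by that of the
vectors `j r`. -/
theorem inner_iterate_iterate {M : Type*} {X : K →ₗᵢ[ℂ] K} {Y : M → M} {j : M → K}
    (h : ∀ r, X (j (Y r)) = j r) (n m : ℕ) (r s : M) :
    inner ℂ (X^[n] (j r)) (X^[m] (j s)) = inner ℂ (j (Y^[m] r)) (j (Y^[n] s)) := by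
  have h1 : ∀ (k : ℕ) x y, inner ℂ (X^[k] x) (X^[k] y) = inner ℂ x y := fun k => by
    induction k with
    | zero => exact fun x y => rfl
    | succ k ih =>
      intro x y
      rw [Function.iterate_succ_apply, Function.iterate_succ_apply, ih, X.inner_map_map]
  rw [← pow_apply_of_apply h m r, ← Function.iterate_add_apply, ← pow_apply_of_apply h n s,
    ← Function.iterate_add_apply, add_comm m n, h1]

theorem coe_pow_isometryEquiv (W : K ≃ₗᵢ[ℂ] K) (n : ℕ) (x : K) : (W ^ n) x = W^[n] x := by
  induction n generalizing x with
  | zero => rfl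
  | succ n ih => rw [pow_succ, LinearIsometryEquiv.coe_mul, Function.comp_apply, ih,
      Function.iterate_succ_apply]

end Gram

/-! ### Unitary extension of a `q`-commuting pair of isometries. -/

section CanonicalPair

variable {R : Type u} [NormedAddCommGroup R] [InnerProductSpace ℂ R]
variable {𝒬 : Type u} [NormedAddCommGroup 𝒬] [InnerProductSpace ℂ 𝒬] [CompleteSpace 𝒬]

/-- An isometry that commutes up to a unimodular factor with an isometry `Y` extends to the space
of the minimal unitary extension of `Y`. -/
theorem exists_extension_of_qcomm {ι : R →ₗᵢ[ℂ] 𝒬} {W : 𝒬 ≃ₗᵢ[ℂ] 𝒬} {Y Z : R →ₗᵢ[ℂ] R}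
    (hW : ∀ r, W (ι (Y r)) = ι r)
    (htot : (Submodule.span ℂ (Set.range fun p : ℕ × R =>
      (W ^ p.1) (ι p.2))).topologicalClosure = ⊤)
    (c : Circle) (hZ : ∀ r, Y (Z r) = (c : ℂ) • Z (Y r)) :
    ∃ S : 𝒬 →ₗᵢ[ℂ] 𝒬, ∀ n r, S ((W ^ n) (ι r)) = (c : ℂ) ^ n • (W ^ n) (ι (Z r)) := by
  have hZ' : ∀ n r, Y^[n] (Z r) = (c : ℂ) ^ n • Z (Y^[n] r) := fun n => by
    induction n with
    | zero => simp
    | succ n ih =>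
      intro r
      rw [Function.iterate_succ_apply', ih, map_smul, hZ, Function.iterate_succ_apply', smul_smul,
        pow_succ]
  have hc : ∀ n : ℕ, (starRingEnd ℂ) ((c : ℂ) ^ n) * (c : ℂ) ^ n = 1 := fun n => by
    rw [map_pow, circle_conj, ← mul_pow, circle_inv_mul, one_pow]
  obtain ⟨S, hS⟩ := exists_linearIsometry_of_inner_eq (fun p : ℕ × R => (W ^ p.1) (ι p.2))
    (fun p : ℕ × R => (c : ℂ) ^ p.1 • (W ^ p.1) (ι (Z p.2))) htot (by
      rintro ⟨n, r⟩ ⟨m, s⟩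
      have h1 := fun n m => inner_iterate_iterate (X := W.toLinearIsometry) (j := ι) hW n m
      simp only [coe_pow_isometryEquiv, inner_smul_left, inner_smul_right]
      have h2 := h1 n m r s
      have h3 := h1 n m (Z r) (Z s)
      simp only [LinearIsometryEquiv.coe_toLinearIsometry, ι.inner_map_map] at h2 h3
      rw [h2, h3, hZ', hZ', inner_smul_left, inner_smul_right, Z.inner_map_map]
      -- The weights `cⁿ`, `cᵐ` in the definition of the target family meet the conjugates of those
      -- produced by `Yⁿ Z = cⁿ Z Yⁿ`, so all four cancel.
      linear_combination (inner ℂ (Y^[m] r) (Y^[n] s)) *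
        (-1 * (starRingEnd ℂ) ((c : ℂ) ^ m) * (c : ℂ) ^ m * hc n - hc m))
  exact ⟨S, fun n r => hS (n, r)⟩

/-- A `q`-commuting pair of isometries `(Y₂, Y₁)` extends to a `q`-commuting pair of unitaries on
the space of the minimal unitary extension of `Y₂ Y₁`. -/
theorem exists_unitary_pair {ι : R →ₗᵢ[ℂ] 𝒬} {W : 𝒬 ≃ₗᵢ[ℂ] 𝒬} {Y₁ Y₂ : R →ₗᵢ[ℂ] R} (q : Circle)
    (hY : ∀ r, Y₁ (Y₂ r) = (q : ℂ) • Y₂ (Y₁ r)) (hW : ∀ r, W (ι (Y₂ (Y₁ r))) = ι r)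
    (htot : (Submodule.span ℂ (Set.range fun p : ℕ × R =>
      (W ^ p.1) (ι p.2))).topologicalClosure = ⊤) :
    ∃ W₁ W₂ : 𝒬 ≃ₗᵢ[ℂ] 𝒬, (∀ r, W₁.symm (ι r) = ι (Y₁ r)) ∧ (∀ r, W₂.symm (ι r) = ι (Y₂ r)) ∧
      (∀ x, W₁ (W₂ x) = (q : ℂ) • W₂ (W₁ x)) ∧
      ∀ x, W₁.symm (W₂.symm x) = (q : ℂ) • W.symm x := by
  have hYi : ∀ r, Y₂ (Y₁ r) = ((q⁻¹ : Circle) : ℂ) • Y₁ (Y₂ r) := fun r => by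
    rw [hY, smul_smul, circle_inv_mul, one_smul]
  -- The weights come from `(Y₂Y₁)Y₁ = q̄ Y₁(Y₂Y₁)` and `(Y₂Y₁)Y₂ = q Y₂(Y₂Y₁)`; being inverse to
  -- each other, they cancel in `S₂S₁` and in `S₁S₂`.
  obtain ⟨S₁, hS₁⟩ := exists_extension_of_qcomm (Y := Y₂.comp Y₁) (Z := Y₁) hW htot q⁻¹ fun r =>
    hYi (Y₁ r)
  obtain ⟨S₂, hS₂⟩ := exists_extension_of_qcomm (Y := Y₂.comp Y₁) (Z := Y₂) hW htot q fun r => by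
    change Y₂ (Y₁ (Y₂ r)) = _
    rw [hY, map_smul]
    rfl
  have hWs : ∀ n r, W.symm ((W ^ n) (ι r)) = (W ^ n) (ι (Y₂ (Y₁ r))) := fun n r => by
    rw [LinearIsometryEquiv.symm_apply_eq, ← hW r, coe_pow_isometryEquiv, coe_pow_isometryEquiv,
      ← Function.iterate_succ_apply, Function.iterate_succ_apply']
  have h21 : ∀ x, S₂ (S₁ x) = W.symm x := fun x => by
    have := clm_ext_of_total htot (A := S₂.toContinuousLinearMap ∘L S₁.toContinuousLinearMap)
      (B := unitaryOp W.symm) fun ⟨n, r⟩ => by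
        change S₂ (S₁ ((W ^ n) (ι r))) = W.symm ((W ^ n) (ι r))
        rw [hWs, hS₁, map_smul, hS₂, smul_smul, ← mul_pow, circle_inv_mul, one_pow, one_smul]
    exact congr($this x)
  have h12 : ∀ x, S₁ (S₂ x) = (q : ℂ) • W.symm x := fun x => by
    have := clm_ext_of_total htot (A := S₁.toContinuousLinearMap ∘L S₂.toContinuousLinearMap)
      (B := (q : ℂ) • unitaryOp W.symm) fun ⟨n, r⟩ => by
        change S₁ (S₂ ((W ^ n) (ι r))) = (q : ℂ) • W.symm ((W ^ n) (ι r))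
        rw [hWs, hS₂, map_smul, hS₁, smul_smul, ← mul_pow, circle_mul_inv, one_pow, one_smul, hY,
          map_smul, map_smul]
    exact congr($this x)
  -- `S₂S₁ = W*` and `S₁S₂ = qW*` are surjective, hence so are both factors. The unitaries sought
  -- are the inverses of `S₁` and `S₂`.
  have hs₂ : Function.Surjective S₂ := fun y => ⟨S₁ (W y), by rw [h21, W.symm_apply_apply]⟩
  have hs₁ : Function.Surjective S₁ := fun y => ⟨S₂ (W (((q⁻¹ : Circle) : ℂ) • y)), by
    rw [h12, W.symm_apply_apply, smul_smul, circle_mul_inv, one_smul]⟩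
  let E₁ := LinearIsometryEquiv.ofSurjective S₁ hs₁
  let E₂ := LinearIsometryEquiv.ofSurjective S₂ hs₂
  refine ⟨E₁.symm, E₂.symm, fun r => ?_, fun r => ?_, fun x => ?_, h12⟩
  · have h := hS₁ 0 r
    rwa [pow_zero, pow_zero, one_smul] at h
  · have h := hS₂ 0 r
    rwa [pow_zero, pow_zero, one_smul] at h
  · rw [LinearIsometryEquiv.symm_apply_eq, LinearIsometryEquiv.symm_apply_eq, map_smul, map_smul]
    obtain ⟨z, rfl⟩ := hs₂.comp hs₁ x
    have e1 : ∀ y, E₁ y = S₁ y := fun y => rfl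
    have e2 : ∀ y, E₂ y = S₂ y := fun y => rfl
    have e3 : E₁.symm ((S₂ ∘ S₁) z) = ((q⁻¹ : Circle) : ℂ) • E₂ z := by
      rw [LinearIsometryEquiv.symm_apply_eq, map_smul, e1, e2, h12, smul_smul, circle_inv_mul,
        one_smul]
      exact h21 z
    rw [e3, map_smul, E₂.symm_apply_apply, map_smul, map_smul, smul_smul, circle_mul_inv, one_smul]
    rfl

/-- Every `q`-commuting pair of isometries has a `q`-commuting unitary extension whose product is
the minimal unitary extension of the product. -/
theorem exists_unitary_pair_extension [CompleteSpace R] (Y₁ Y₂ : R →ₗᵢ[ℂ] R) (q : Circle)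
    (hY : ∀ r, Y₁ (Y₂ r) = (q : ℂ) • Y₂ (Y₁ r)) :
    ∃ (𝒬 : Type u) (_ : NormedAddCommGroup 𝒬) (_ : InnerProductSpace ℂ 𝒬)
      (_ : CompleteSpace 𝒬) (ι : R →ₗᵢ[ℂ] 𝒬) (W W₁ W₂ : 𝒬 ≃ₗᵢ[ℂ] 𝒬),
      (∀ r, W.symm (ι r) = ι (Y₂ (Y₁ r))) ∧
      (Submodule.span ℂ (Set.range fun p : ℕ × R => (W ^ p.1) (ι p.2))).topologicalClosure = ⊤ ∧
      (∀ r, W₁.symm (ι r) = ι (Y₁ r)) ∧ (∀ r, W₂.symm (ι r) = ι (Y₂ r)) ∧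
      (∀ x, W₁ (W₂ x) = (q : ℂ) • W₂ (W₁ x)) ∧
      ∀ x, W₁.symm (W₂.symm x) = (q : ℂ) • W.symm x := by
  obtain ⟨𝒬, i1, i2, i3, ι, W, hW, htot⟩ := exists_minimal_unitary_extension (Y₂.comp Y₁)
  obtain ⟨W₁, W₂, e1, e2, e3, e4⟩ := exists_unitary_pair q hY hW htot
  refine ⟨𝒬, i1, i2, i3, ι, W, W₁, W₂, fun r => ?_, htot, e1, e2, e3, e4⟩
  rw [LinearIsometryEquiv.symm_apply_eq]
  exact (hW r).symm

end CanonicalPair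

/-! ### Existence of the canonical pair. -/

section Existence

variable {H : Type u} [NormedAddCommGroup H] [InnerProductSpace ℂ H] [CompleteSpace H]
variable {q : Circle} {T₁ T₂ : H →L[ℂ] H}

theorem norm_Qop_adjoint {T : H →L[ℂ] H} (hT : ‖T‖ ≤ 1) (h : H) :
    ‖Qop T hT (adjoint T h)‖ = ‖Qop T hT h‖ := by
  rw [← sq_eq_sq₀ (norm_nonneg _) (norm_nonneg _)]
  refine tendsto_nhds_unique (norm_Qop_sq hT (adjoint T h)) ?_
  refine ((tendsto_add_atTop_iff_nat 1).2 (norm_Qop_sq hT h)).congr fun n => ?_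
  rw [pow_succ (adjoint T), mul_apply_eq_comp]

/-- Pass to the limit in `‖T*ⁿ A x‖ = ‖A T*ⁿ x‖ ≤ ‖T*ⁿ x‖`. -/
theorem norm_Qop_adjoint_le {T A : H →L[ℂ] H} (hT : ‖T‖ ≤ 1) (hA : ‖A‖ ≤ 1) {c : Circle}
    (h : A * adjoint T = (c : ℂ) • (adjoint T * A)) (x : H) :
    ‖Qop T hT (A x)‖ ≤ ‖Qop T hT x‖ := by
  rw [← sq_le_sq₀ (norm_nonneg _) (norm_nonneg _)]
  refine le_of_tendsto_of_tendsto' (norm_Qop_sq hT (A x)) (norm_Qop_sq hT x) fun n => ?_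
  gcongr
  have h1 := congr(‖$(mul_pow_of_qcomm h n) x‖)
  rw [mul_apply_eq_comp, smul_apply, norm_smul, norm_pow, Circle.norm_coe, one_pow, one_mul,
    mul_apply_eq_comp] at h1
  rw [← h1]
  exact norm_apply_le hA _

/-- A sandwich: `‖Qh‖ = ‖QT*h‖ = ‖QT₂*T₁*h‖ ≤ ‖QT₁*h‖ ≤ ‖Qh‖`. The same argument for `T₂*` uses
`T₁*T₂* = qT*`. -/
theorem norm_Qop_adjoint₁ (hT : IsQContractivePair q T₁ T₂) (h : H) :
    ‖Qop (T₁ * T₂) hT.norm_mul_le (adjoint T₁ h)‖ = ‖Qop (T₁ * T₂) hT.norm_mul_le h‖ := by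
  refine le_antisymm (norm_Qop_adjoint_le _ (norm_adjoint_le hT.norm_le₁)
    (adjoint₁_apply_adjoint_mul hT.qcomm) h) ?_
  rw [← norm_Qop_adjoint hT.norm_mul_le h]
  have h2 : adjoint (T₁ * T₂) h = adjoint T₂ (adjoint T₁ h) := by rw [adjoint_mul]; rfl
  rw [h2]
  refine norm_Qop_adjoint_le (c := q⁻¹) _ (norm_adjoint_le hT.norm_le₂) ?_ _
  rw [adjoint₂_apply_adjoint_mul hT.qcomm, smul_smul, circle_inv_mul, one_smul]

theorem norm_Qop_adjoint₂ (hT : IsQContractivePair q T₁ T₂) (h : H) :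
    ‖Qop (T₁ * T₂) hT.norm_mul_le (adjoint T₂ h)‖ = ‖Qop (T₁ * T₂) hT.norm_mul_le h‖ := by
  refine le_antisymm (norm_Qop_adjoint_le (c := q⁻¹) _ (norm_adjoint_le hT.norm_le₂) (by
    rw [adjoint₂_apply_adjoint_mul hT.qcomm, smul_smul, circle_inv_mul, one_smul]) h) ?_
  rw [← norm_Qop_adjoint hT.norm_mul_le h]
  have h2 := congr($(mul_adjoint_of_qcomm hT.qcomm) h)
  rw [mul_apply_eq_comp, smul_apply] at h2
  have h3 := norm_Qop_adjoint_le hT.norm_mul_le (norm_adjoint_le hT.norm_le₁)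
    (adjoint₁_apply_adjoint_mul hT.qcomm) (adjoint T₂ h)
  rwa [h2, map_smul, norm_smul, Circle.norm_coe, one_mul] at h3

/-- Equality of norms lets `T₁*` and `T₂*` descend to isometries `Y₁`, `Y₂` of the closed range of
`Q_{T*}`. They inherit `Y₁Y₂ = qY₂Y₁`, and `Y₂Y₁` is the isometry induced by `T*`. -/
theorem exists_canonicalPair (hT : IsQContractivePair q T₁ T₂) :
    ∃ (𝒬 : Type u) (_ : NormedAddCommGroup 𝒬) (_ : InnerProductSpace ℂ 𝒬)
      (_ : CompleteSpace 𝒬), Nonempty (CanonicalPair hT 𝒬) := by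
  set Q := toClosedRange (Qop (T₁ * T₂) hT.norm_mul_le) with hQ
  have hd := denseRange_toClosedRange (Qop (T₁ * T₂) hT.norm_mul_le)
  obtain ⟨Y₁, hY₁⟩ := exists_linearIsometry_of_norm_eq Q.toLinearMap
    (Q ∘L adjoint T₁).toLinearMap hd (norm_Qop_adjoint₁ hT)
  obtain ⟨Y₂, hY₂⟩ := exists_linearIsometry_of_norm_eq Q.toLinearMap
    (Q ∘L adjoint T₂).toLinearMap hd (norm_Qop_adjoint₂ hT)
  have k1 : ∀ h, Y₁ (Q h) = Q (adjoint T₁ h) := hY₁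
  have k2 : ∀ h, Y₂ (Q h) = Q (adjoint T₂ h) := hY₂
  have hY : ∀ r, Y₁ (Y₂ r) = (q : ℂ) • Y₂ (Y₁ r) := fun r => by
    refine hd.induction_on (p := fun r => Y₁ (Y₂ r) = (q : ℂ) • Y₂ (Y₁ r)) r
      (isClosed_eq (by fun_prop) (by fun_prop)) fun h => ?_
    rw [← hQ, k1, k2, k1, k2, ← map_smul]
    congr 1
    have h1 := congr($(mul_adjoint_of_qcomm hT.qcomm) h)
    rwa [adjoint_mul] at h1
  obtain ⟨𝒬, i1, i2, i3, ι, W, W₁, W₂, e0, htot, e1, e2, e3, e4⟩ :=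
    exists_unitary_pair_extension Y₁ Y₂ q hY
  refine ⟨𝒬, i1, i2, i3, ⟨⟨ι, W, W₁, W₂, fun h => ?_, htot, fun h => ?_, fun h => ?_, e3, e4⟩⟩⟩
  · rw [e0, k1, k2, adjoint_mul]
    rfl
  · rw [e1, k1]
  · rw [e2, k2]

end Existence

/-! ### The wandering subspace of `V₁V₂` and the Andô tuple that it carries. -/

section Wandering

variable {K : Type w} [NormedAddCommGroup K] [InnerProductSpace ℂ K] [CompleteSpace K]

/-- The adjoint of an isometry. -/
abbrev adj (V : K →ₗᵢ[ℂ] K) : K →L[ℂ] K := adjoint V.toContinuousLinearMap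

theorem adj_comp (V₁ V₂ : K →ₗᵢ[ℂ] K) (k : K) : adj (V₁.comp V₂) k = adj V₂ (adj V₁ k) :=
  congr($(adjoint_mul V₁.toContinuousLinearMap V₂.toContinuousLinearMap) k)

/-- A `q`-commuting pair of isometries: `V₁ V₂ = q V₂ V₁`. -/
def QComm (q : Circle) (V₁ V₂ : K →ₗᵢ[ℂ] K) : Prop := ∀ k, V₁ (V₂ k) = (q : ℂ) • V₂ (V₁ k)

variable {q : Circle} {V₁ V₂ : K →ₗᵢ[ℂ] K}

theorem QComm.swap (h : QComm q V₁ V₂) : QComm q⁻¹ V₂ V₁ := fun k => by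
  rw [h, smul_smul, circle_inv_mul, one_smul]

theorem QComm.adj_adj (h : QComm q V₁ V₂) (k : K) :
    adj V₁ (adj V₂ k) = (q : ℂ) • adj V₂ (adj V₁ k) := by
  refine ext_inner_left ℂ fun x => ?_
  rw [inner_smul_right, adjoint_inner_right, adjoint_inner_right, adjoint_inner_right,
    adjoint_inner_right]
  change inner ℂ (V₂ (V₁ x)) k = (q : ℂ) * inner ℂ (V₁ (V₂ x)) k
  rw [h, inner_smul_left, circle_conj, ← mul_assoc, circle_mul_inv, one_mul]

theorem QComm.adj₂_apply (h : QComm q V₁ V₂) (k : K) : adj V₂ (V₁ (V₂ k)) = (q : ℂ) • V₁ k := by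
  rw [h, map_smul, adjoint_apply_isometry]

theorem QComm.adj_adj_apply (h : QComm q V₁ V₂) (k : K) :
    adj V₂ (adj V₁ (V₂ k)) = ((q⁻¹ : Circle) : ℂ) • adj V₁ k := by
  rw [h.swap.adj_adj, adjoint_apply_isometry]

/-- The operator `V₁* + V₂ (I - V₁ V₁*)`. -/
def flipOp (V₁ V₂ : K →ₗᵢ[ℂ] K) : K →L[ℂ] K :=
  adj V₁ + V₂.toContinuousLinearMap * (1 - V₁.toContinuousLinearMap * adj V₁)

theorem flipOp_apply (V₁ V₂ : K →ₗᵢ[ℂ] K) (k : K) :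
    flipOp V₁ V₂ k = adj V₁ k + V₂ (k - V₁ (adj V₁ k)) := rfl

/-- The wandering subspace `ker (V₁ V₂)*`. -/
abbrev wandering (V₁ V₂ : K →ₗᵢ[ℂ] K) : Submodule ℂ K := (adj (V₁.comp V₂)).ker

theorem mem_wandering {k : K} : k ∈ wandering V₁ V₂ ↔ adj V₂ (adj V₁ k) = 0 := by
  rw [LinearMap.mem_ker, ← adj_comp]
  rfl

theorem QComm.mem_wandering_swap (h : QComm q V₁ V₂) {k : K} :
    k ∈ wandering V₁ V₂ ↔ k ∈ wandering V₂ V₁ := by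
  rw [mem_wandering, mem_wandering, h.adj_adj, smul_eq_zero_iff_right (Circle.coe_ne_zero q)]

/-- On `ker (V₁V₂)*` the operator sends `ker V₁* ⊕ V₁ ker V₂*` to `V₂ ker V₁* ⊕ ker V₂*`, by `V₂` on
the first summand and `V₁*` on the second. With the roles of `V₁`, `V₂` exchanged it undoes itself.
-/
theorem QComm.flipOp_mem (h : QComm q V₁ V₂) {k : K} (hk : k ∈ wandering V₁ V₂) :
    flipOp V₁ V₂ k ∈ wandering V₁ V₂ := by
  rw [mem_wandering] at hk
  rw [mem_wandering, flipOp_apply, map_add, map_add, map_sub, map_sub, map_sub, h.adj_adj_apply,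
    h.adj_adj_apply, adjoint_apply_isometry, sub_self, add_zero, h.swap.adj_adj, hk, map_zero,
    smul_zero]

theorem flipOp_flipOp {k : K} (hk : k ∈ wandering V₁ V₂) :
    flipOp V₂ V₁ (flipOp V₁ V₂ k) = k := by
  rw [mem_wandering] at hk
  have h1 : adj V₂ (flipOp V₁ V₂ k) = k - V₁ (adj V₁ k) := by
    rw [flipOp_apply, map_add, hk, zero_add, adjoint_apply_isometry]
  rw [flipOp_apply V₂, h1, flipOp_apply, add_sub_cancel_right, sub_add_cancel]

/-- The two terms are orthogonal because `V₁*k` lies in `ker V₂*`. -/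
theorem norm_flipOp {k : K} (hk : k ∈ wandering V₁ V₂) : ‖flipOp V₁ V₂ k‖ = ‖k‖ := by
  rw [mem_wandering] at hk
  have h1 : inner ℂ (adj V₁ k) (V₂ (k - V₁ (adj V₁ k))) = 0 := by
    change inner ℂ _ (V₂.toContinuousLinearMap _) = _
    rw [← adjoint_inner_left, hk, inner_zero_left]
  have h2 := norm_sq_add_norm_sub_adjoint_sq (W := adj V₁) (fun y => by
    rw [adjoint_adjoint]
    exact adjoint_apply_isometry V₁ _) k
  rw [adjoint_adjoint] at h2
  rw [← sq_eq_sq₀ (norm_nonneg _) (norm_nonneg _), flipOp_apply, norm_add_sq_of_inner_eq_zero h1,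
    V₂.norm_map, ← h2]
  rfl

/-- The unitary on the wandering subspace induced by `V₁* + V₂ (I - V₁ V₁*)`. -/
def flipEquiv (h : QComm q V₁ V₂) : wandering V₁ V₂ ≃ₗᵢ[ℂ] wandering V₁ V₂ where
  toFun f := ⟨flipOp V₁ V₂ f, h.flipOp_mem f.2⟩
  invFun f := ⟨flipOp V₂ V₁ f,
    h.mem_wandering_swap.2 (h.swap.flipOp_mem (h.mem_wandering_swap.1 f.2))⟩
  map_add' f g := Subtype.ext (map_add (flipOp V₁ V₂) (f : K) g)
  map_smul' c f := Subtype.ext (map_smul (flipOp V₁ V₂) c (f : K))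
  left_inv f := Subtype.ext (flipOp_flipOp f.2)
  right_inv f := Subtype.ext (flipOp_flipOp (h.mem_wandering_swap.1 f.2))
  norm_map' f := norm_flipOp f.2

theorem coe_flipEquiv (h : QComm q V₁ V₂) (f : wandering V₁ V₂) :
    (flipEquiv h f : K) = adj V₁ f + V₂ (f - V₁ (adj V₁ f)) := rfl

theorem coe_flipEquiv_symm (h : QComm q V₁ V₂) (f : wandering V₁ V₂) :
    ((flipEquiv h).symm f : K) = adj V₂ f + V₁ (f - V₂ (adj V₂ f)) := rfl

/-- The projection `V₂ V₂*` on the wandering subspace. -/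
def wanderingProj (h : QComm q V₁ V₂) : wandering V₁ V₂ →L[ℂ] wandering V₁ V₂ :=
  ((V₂.toContinuousLinearMap * adj V₂) ∘L (wandering V₁ V₂).subtypeL).codRestrict _ fun f => by
    rw [mem_wandering]
    change adj V₂ (adj V₁ (V₂ (adj V₂ f))) = 0
    rw [h.adj_adj_apply, h.adj_adj, mem_wandering.1 f.2, smul_zero, smul_zero]

theorem coe_wanderingProj (h : QComm q V₁ V₂) (f : wandering V₁ V₂) :
    (wanderingProj h f : K) = V₂ (adj V₂ f) := rfl

theorem coe_one_sub_wanderingProj (h : QComm q V₁ V₂) (f : wandering V₁ V₂) :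
    ((1 - wanderingProj h) f : K) = f - V₂ (adj V₂ f) := rfl

theorem isStarProjection_wanderingProj (h : QComm q V₁ V₂) :
    IsStarProjection (wanderingProj h) := by
  refine ⟨ContinuousLinearMap.ext fun f => Subtype.ext ?_, ?_⟩
  · rw [mul_apply_eq_comp, coe_wanderingProj, coe_wanderingProj, adjoint_apply_isometry]
  · rw [IsSelfAdjoint, star_eq_adjoint]
    symm
    rw [eq_adjoint_iff]
    intro f g
    rw [Submodule.coe_inner, Submodule.coe_inner, coe_wanderingProj, coe_wanderingProj]
    change inner ℂ (V₂.toContinuousLinearMap _) _ = inner ℂ _ (V₂.toContinuousLinearMap _)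
    rw [← adjoint_inner_right, adjoint_inner_left]

theorem coe_coProj_comp (k : K) :
    (coProj (V₁.comp V₂) k : K) = k - V₁ (V₂ (adj V₂ (adj V₁ k))) := by
  rw [coe_coProj]
  change k - V₁ (V₂ (adj (V₁.comp V₂) k)) = _
  rw [adj_comp]

/-- On the wandering space `P^⊥U = V₁*` and `PU = V₂(I - V₁V₁*)`, while `U*P = V₂*` and `U*P^⊥ =
V₁(I - V₂V₂*)`. With these, this identity and the three after it compare words in `V₁`, `V₂` and
their adjoints, brought to a common order by `q`-commutation. The first two become the Andô
identities on the image of `H`. -/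
theorem coProj_adj₁ (h : QComm q V₁ V₂) (k : K) : coProj (V₁.comp V₂) (adj V₁ k) =
    (1 - wanderingProj h) (flipEquiv h (coProj (V₁.comp V₂) k)) +
      wanderingProj h (flipEquiv h (coProj (V₁.comp V₂) (adj (V₁.comp V₂) k))) := by
  refine Subtype.ext ?_
  rw [Submodule.coe_add, coe_one_sub_wanderingProj, coe_wanderingProj, coe_flipEquiv,
    coe_flipEquiv, coe_coProj_comp, coe_coProj_comp, coe_coProj_comp, adj_comp]
  simp only [map_add, map_sub, map_smul, adjoint_apply_isometry, h.adj_adj, h.adj₂_apply,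
    h.swap _, smul_smul, circle_mul_inv, circle_inv_mul, one_smul]
  module

theorem coProj_adj₂ (h : QComm q V₁ V₂) (k : K) : coProj (V₁.comp V₂) (adj V₂ k) =
    (flipEquiv h).symm (wanderingProj h (coProj (V₁.comp V₂) k)) +
      (q : ℂ) • (flipEquiv h).symm ((1 - wanderingProj h)
        (coProj (V₁.comp V₂) (adj (V₁.comp V₂) k))) := by
  refine Subtype.ext ?_
  rw [Submodule.coe_add, Submodule.coe_smul, coe_flipEquiv_symm, coe_flipEquiv_symm,
    coe_one_sub_wanderingProj, coe_wanderingProj, coe_coProj_comp, coe_coProj_comp,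
    coe_coProj_comp, adj_comp]
  simp only [map_sub, map_smul, adjoint_apply_isometry, h.adj_adj, h.adj₂_apply,
    h.swap _, smul_smul, circle_mul_inv, one_smul]
  have hq := Circle.coe_ne_zero q
  match_scalars <;> (try field_simp) <;> ring

theorem coProj_apply₁ (h : QComm q V₁ V₂) (k : K) : coProj (V₁.comp V₂) (V₁ k) =
    (flipEquiv h).symm ((1 - wanderingProj h) (coProj (V₁.comp V₂) k)) := by
  refine Subtype.ext ?_
  rw [coe_flipEquiv_symm, coe_one_sub_wanderingProj, coe_coProj_comp, coe_coProj_comp]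
  simp only [map_sub, map_smul, adjoint_apply_isometry, h.adj₂_apply,
    h.swap _, smul_smul, circle_mul_inv, one_smul]
  module

theorem coProj_apply₂ (h : QComm q V₁ V₂) (k : K) : coProj (V₁.comp V₂) (V₂ k) =
    wanderingProj h (flipEquiv h (coProj (V₁.comp V₂) k)) := by
  refine Subtype.ext ?_
  rw [coe_wanderingProj, coe_flipEquiv, coe_coProj_comp, coe_coProj_comp]
  simp only [map_add, map_sub, map_smul, adjoint_apply_isometry, h.adj₂_apply,
    h.adj_adj_apply, h.swap _, smul_smul, circle_inv_mul, one_smul]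
  module

end Wandering

/-! ### The Wold decomposition of a single isometry. -/

section Wold

variable {K : Type w} [NormedAddCommGroup K] [InnerProductSpace ℂ K] [CompleteSpace K]
variable (V : K →ₗᵢ[ℂ] K)

theorem sum_norm_coProj (k : K) (N : ℕ) :
    ∑ n ∈ Finset.range N, ‖coProj V ((adj V ^ n) k)‖ ^ 2 = ‖k‖ ^ 2 - ‖(adj V ^ N) k‖ ^ 2 := by
  induction N with
  | zero => simp
  | succ N ih =>
    have h1 := norm_coProj_sq V ((adj V ^ N) k)
    rw [Finset.sum_range_succ, ih, pow_succ' (adj V), mul_apply_eq_comp]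
    linarith

theorem summable_norm_coProj (k : K) :
    Summable fun n : ℕ => ‖coProj V ((adj V ^ n) k)‖ ^ 2 := by
  refine summable_of_sum_range_le (c := ‖k‖ ^ 2) (fun n => by positivity) fun N => ?_
  rw [sum_norm_coProj]
  have : 0 ≤ ‖(adj V ^ N) k‖ ^ 2 := by positivity
  linarith

theorem memℓp_coProj (k : K) : Memℓp (fun n : ℕ => coProj V ((adj V ^ n) k)) 2 :=
  memℓp_gen (by simpa using summable_norm_coProj V k)

/-- The map `k ↦ ∑ zⁿ (I - V V*) V*ⁿ k` onto the shift part of the Wold decomposition of `V`. -/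
def shiftPart : K →ₗ[ℂ] H2 (adj V).ker where
  toFun k := ⟨fun n => coProj V ((adj V ^ n) k), memℓp_coProj V k⟩
  map_add' x y := H2.ext fun n => ((coProj V).comp (adj V ^ n)).map_add x y
  map_smul' c x := H2.ext fun n => ((coProj V).comp (adj V ^ n)).map_smul c x

theorem shiftPart_apply (k : K) (n : ℕ) : shiftPart V k n = coProj V ((adj V ^ n) k) := rfl

/-- The projection onto the unitary part of the Wold decomposition of `V`. -/
def woldProj : K →L[ℂ] K :=
  asymptoticLimit V.toContinuousLinearMap V.norm_toContinuousLinearMap_le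

theorem tendsto_woldProj (k : K) :
    Tendsto (fun n : ℕ => V^[n] ((adj V ^ n) k)) atTop (𝓝 (woldProj V k)) := by
  refine (tendsto_asymptoticLimit V.norm_toContinuousLinearMap_le k).congr fun n => ?_
  rw [mul_apply_eq_comp, FunLike.coe_pow_eq_iterate]
  rfl

theorem inner_woldProj (k : K) : inner ℂ (woldProj V k) k =
    ((‖Qop V.toContinuousLinearMap V.norm_toContinuousLinearMap_le k‖ ^ 2 : ℝ) : ℂ) :=
  (norm_sqrt_sq (asymptoticLimit_nonneg V.norm_toContinuousLinearMap_le) k).symm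

theorem norm_shiftPart_sq (k : K) : ‖shiftPart V k‖ ^ 2 +
    ‖Qop V.toContinuousLinearMap V.norm_toContinuousLinearMap_le k‖ ^ 2 = ‖k‖ ^ 2 := by
  have h1 := (H2.norm_sq (shiftPart V k)).tendsto_sum_nat
  have h2 := h1.congr fun N => sum_norm_coProj V k N
  have h3 := tendsto_nhds_unique h2 (tendsto_const_nhds.sub
    (norm_Qop_sq V.norm_toContinuousLinearMap_le k))
  linarith

theorem adjoint_woldProj : adjoint (woldProj V) = woldProj V :=
  ((nonneg_iff_isPositive _).1
    (asymptoticLimit_nonneg V.norm_toContinuousLinearMap_le)).isSelfAdjoint.adjoint_eq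

/-- Shifting the index by one does not change the limit of `VⁿV*ⁿ`. -/
theorem woldProj_adj (k : K) : V (woldProj V (adj V k)) = woldProj V k := by
  refine tendsto_nhds_unique ((V.continuous.tendsto _).comp (tendsto_woldProj V (adj V k))) ?_
  refine ((tendsto_add_atTop_iff_nat 1).2 (tendsto_woldProj V k)).congr fun n => ?_
  rw [Function.iterate_succ_apply', pow_succ (adj V), mul_apply_eq_comp]
  rfl

theorem woldProj_apply (k : K) : woldProj V (V k) = V (woldProj V k) := by
  rw [← woldProj_adj V (V k), adjoint_apply_isometry]

theorem adj_woldProj (k : K) : adj V (woldProj V k) = woldProj V (adj V k) := by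
  rw [← woldProj_adj V k, adjoint_apply_isometry]

theorem iterate_adj_pow_woldProj (n : ℕ) (k : K) :
    V^[n] ((adj V ^ n) (woldProj V k)) = woldProj V k := by
  induction n generalizing k with
  | zero => rfl
  | succ n ih =>
    rw [Function.iterate_succ_apply', pow_succ (adj V), mul_apply_eq_comp, adj_woldProj, ih,
      woldProj_adj]

theorem adj_pow_iterate (n : ℕ) (k : K) : (adj V ^ n) (V^[n] k) = k := by
  induction n generalizing k with
  | zero => rfl
  | succ n ih =>
    rw [Function.iterate_succ_apply', pow_succ (adj V), mul_apply_eq_comp, adjoint_apply_isometry,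
      ih]

/-- Together with `iterate_adj_pow_woldProj` this identifies the range of the limit as the set of
vectors fixed by every `VⁿV*ⁿ`; idempotence follows. -/
theorem woldProj_eq_self {k : K} (h : ∀ n, V^[n] ((adj V ^ n) k) = k) : woldProj V k = k :=
  tendsto_nhds_unique (tendsto_woldProj V k) (by simp only [h]; exact tendsto_const_nhds)

theorem woldProj_woldProj (k : K) : woldProj V (woldProj V k) = woldProj V k :=
  woldProj_eq_self V fun n => iterate_adj_pow_woldProj V n k

theorem coProj_woldProj (k : K) : coProj V (woldProj V k) = 0 := by
  refine Subtype.ext ?_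
  rw [coe_coProj]
  change woldProj V k - V (adj V (woldProj V k)) = 0
  rw [adj_woldProj, woldProj_adj, sub_self]

theorem shiftPart_woldProj (k : K) : shiftPart V (woldProj V k) = 0 := by
  refine H2.ext fun n => ?_
  have h : (adj V ^ n) (woldProj V k) = woldProj V ((adj V ^ n) k) := by
    induction n generalizing k with
    | zero => rfl
    | succ n ih => rw [pow_succ (adj V), mul_apply_eq_comp, adj_woldProj, ih]; rfl
  rw [shiftPart_apply, h, coProj_woldProj]
  rfl

theorem woldProj_of_mem_ker {k : K} (h : adj V k = 0) : woldProj V k = 0 := by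
  rw [← woldProj_adj, h, map_zero, map_zero]

theorem coProj_apply_self (k : K) : coProj V (V k) = 0 := by
  refine Subtype.ext ?_
  rw [coe_coProj, adjoint_apply_isometry, sub_self]
  rfl

theorem shiftPart_apply_self (k : K) : shiftPart V (V k) = shift _ (shiftPart V k) := by
  refine H2.ext fun n => ?_
  cases n with
  | zero => exact coProj_apply_self V k
  | succ n =>
    rw [shiftPart_apply, shift_apply_succ, shiftPart_apply, pow_succ (adj V), mul_apply_eq_comp,
      adjoint_apply_isometry]

theorem shiftPart_coe (a : (adj V).ker) : shiftPart V (a : K) = lp.single 2 0 a := by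
  refine H2.ext fun n => ?_
  have ha : adj V (a : K) = 0 := a.2
  cases n with
  | zero =>
    rw [lp.single_apply_self, shiftPart_apply]
    refine Subtype.ext ?_
    rw [coe_coProj]
    change (a : K) - V (adj V (a : K)) = a
    rw [ha, map_zero, sub_zero]
  | succ n =>
    rw [lp.single_apply_ne _ _ _ n.succ_ne_zero, shiftPart_apply, pow_succ (adj V),
      mul_apply_eq_comp, ha, map_zero, map_zero]

theorem shift_single {F : Type*} [NormedAddCommGroup F] [InnerProductSpace ℂ F] (n : ℕ) (a : F) :
    shift F (lp.single 2 n a) = lp.single 2 (n + 1) a := by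
  refine H2.ext fun m => ?_
  cases m with
  | zero => exact (lp.single_apply_ne (E := fun _ : ℕ => F) 2 (n + 1) a (j := 0)
      n.succ_ne_zero.symm).symm
  | succ m =>
    rw [shift_apply_succ]
    by_cases h : m = n
    · rw [h, lp.single_apply_self, lp.single_apply_self]
    · rw [lp.single_apply_ne _ _ _ h, lp.single_apply_ne _ _ _ (by omega)]

/-- This gives surjectivity onto the Hardy space: each `zⁿ a` comes from `Vⁿ a` with `a ∈ ker V*`.
-/
theorem shiftPart_iterate_coe (n : ℕ) (a : (adj V).ker) :
    shiftPart V (V^[n] (a : K)) = lp.single 2 n a := by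
  induction n with
  | zero => exact shiftPart_coe V a
  | succ n ih => rw [Function.iterate_succ_apply', shiftPart_apply_self, ih, shift_single]

theorem qcomm_iterate {M : Type*} [AddCommGroup M] [Module ℂ M] {X : M → M} {Y : M →ₗ[ℂ] M} {c : ℂ}
    (h : ∀ k, X (Y k) = c • Y (X k)) (n : ℕ) (k : M) :
    X (Y^[n] k) = c ^ n • Y^[n] (X k) := by
  induction n generalizing k with
  | zero => simp
  | succ n ih =>
    have h1 : ∀ (d : ℂ) (k : M), Y^[n] (d • k) = d • Y^[n] k := fun d k => by
      rw [← Module.End.coe_pow, map_smul]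
    rw [Function.iterate_succ_apply, ih, h, h1, smul_smul, Function.iterate_succ_apply, pow_succ]

variable {V}

/-- A vector of the unitary part is some `Vⁿ y` for each `n`, and `XVⁿ = cⁿVⁿX` keeps its image in
the range of `Vⁿ`. -/
theorem woldProj_mul_woldProj {X : K →L[ℂ] K} {c : ℂ} (h : ∀ k, X (V k) = c • V (X k)) (k : K) :
    woldProj V (X (woldProj V k)) = X (woldProj V k) := by
  refine woldProj_eq_self V fun n => ?_
  have h1 := qcomm_iterate (Y := V.toLinearMap) h n
    ((adj V ^ n) (woldProj V k))
  have h2 : X (woldProj V k) = c ^ n • V^[n] (X ((adj V ^ n) (woldProj V k))) := by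
    exact (congrArg X (iterate_adj_pow_woldProj V n k).symm).trans h1
  have h3 : ∀ (d : ℂ) (k : K), V^[n] (d • k) = d • V^[n] k := fun d k => by
    have := map_smul (V.toLinearMap ^ n) d k
    rwa [Module.End.coe_pow] at this
  rw [h2, map_smul, adj_pow_iterate, h3]

/-- The unitary part of `V` reduces `X` if `X V = c V X` and `X* V = Y` with `Y V = d V Y`. -/
theorem woldProj_comm {X Y : K →L[ℂ] K} {c d : ℂ} (hX : ∀ k, X (V k) = c • V (X k))
    (hY : ∀ k, Y (V k) = d • V (Y k)) (hXY : ∀ k, adjoint X (V k) = Y k) (k : K) :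
    woldProj V (X k) = X (woldProj V k) := by
  -- A vector of the unitary part is `V` of another one, and `X*V = Y` keeps the unitary part
  -- invariant. So it is invariant under `X*` as well as under `X`, that is, it reduces `X`.
  have h1 : ∀ k, woldProj V (adjoint X (woldProj V k)) = adjoint X (woldProj V k) := fun k => by
    rw [← woldProj_adj V k, hXY, woldProj_mul_woldProj hY]
  refine Eq.trans ?_ (woldProj_mul_woldProj hX k)
  refine ext_inner_left ℂ fun y => ?_
  rw [← adjoint_inner_left, adjoint_woldProj, ← adjoint_inner_left, ← h1,
    ← adjoint_inner_left (woldProj V) (X _), adjoint_woldProj, ← adjoint_inner_left X,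
    ← adjoint_inner_left (woldProj V) k, adjoint_woldProj]

end Wold

/-! ### Action of `V₁` and `V₂` on the unitary part of `V₁V₂`. -/

section UnitaryPart

variable {K : Type w} [NormedAddCommGroup K] [InnerProductSpace ℂ K] [CompleteSpace K]
variable {q : Circle} {V₁ V₂ V : K →ₗᵢ[ℂ] K}

/-- The limit is an orthogonal projection, so it has the same norms as its positive square root. -/
theorem norm_woldProj (V : K →ₗᵢ[ℂ] K) (k : K) : ‖woldProj V k‖ =
    ‖Qop V.toContinuousLinearMap V.norm_toContinuousLinearMap_le k‖ := by
  rw [← sq_eq_sq₀ (norm_nonneg _) (norm_nonneg _)]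
  have h : ((‖woldProj V k‖ ^ 2 : ℝ) : ℂ) = inner ℂ (woldProj V k) k := by
    rw [← woldProj_woldProj, ← adjoint_woldProj, adjoint_inner_left, adjoint_woldProj,
      woldProj_woldProj, inner_self_eq_norm_sq_to_K]
    norm_cast
  rw [inner_woldProj] at h
  exact_mod_cast h

theorem QComm.woldProj_apply₁ (h : QComm q V₁ V₂) (k : K) :
    woldProj (V₁.comp V₂) (V₁ k) = V₁ (woldProj (V₁.comp V₂) k) := by
  refine woldProj_comm (X := V₁.toContinuousLinearMap) (Y := V₂.toContinuousLinearMap) (c := q)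
    (d := (q⁻¹ : Circle)) (fun k => ?_) (fun k => ?_) (fun k => ?_) k
  · change V₁ (V₁ (V₂ k)) = (q : ℂ) • V₁ (V₂ (V₁ k))
    rw [h k, map_smul]
  · exact h.swap (V₂ k)
  · exact adjoint_apply_isometry V₁ (V₂ k)

theorem QComm.woldProj_apply₂ (h : QComm q V₁ V₂) (k : K) :
    woldProj (V₁.comp V₂) (V₂ k) = V₂ (woldProj (V₁.comp V₂) k) := by
  refine woldProj_comm (X := V₂.toContinuousLinearMap) (Y := (q : ℂ) • V₁.toContinuousLinearMap)
    (c := (q⁻¹ : Circle)) (d := q) (fun k => h.swap (V₂ k)) (fun k => ?_) (fun k => ?_) k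
  · rw [smul_apply, smul_apply, map_smul]
    exact congrArg (fun x => (q : ℂ) • x) ((congrArg V₁ (h k)).trans (V₁.map_smul _ _))
  · rw [smul_apply]
    exact h.adj₂_apply k

theorem apply_adj_woldProj {X : K →ₗᵢ[ℂ] K} (h : ∀ k, ∃ l, woldProj V k = X l) (k : K) :
    X (adj X (woldProj V k)) = woldProj V k := by
  obtain ⟨l, hl⟩ := h k
  rw [hl, adjoint_apply_isometry]

theorem woldProj_adj_comm {X : K →ₗᵢ[ℂ] K} (h : ∀ k, woldProj V (X k) = X (woldProj V k)) (k : K) :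
    woldProj V (adj X k) = adj X (woldProj V k) := by
  refine ext_inner_left ℂ fun y => ?_
  rw [← adjoint_inner_left, adjoint_woldProj, adjoint_inner_right, adjoint_inner_right,
    ← adjoint_inner_left (woldProj V), adjoint_woldProj]
  exact congrArg (inner ℂ · k) (h y).symm

/-- The unitary part lies in the range of `V₂`, so `V₂V₂*` is the identity there and `V₁ = V₁V₂V₂*`.
This expresses `V₁` through `V₁V₂` and `V₂*`, whose action on the image of `H` is known from the
lift. -/
theorem QComm.woldProj_eq₁ (h : QComm q V₁ V₂) (k : K) : V₁ (woldProj (V₁.comp V₂) k) =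
    (V₁.comp V₂) (woldProj (V₁.comp V₂) (adj V₂ k)) := by
  have h1 : V₂ (adj V₂ (woldProj (V₁.comp V₂) k)) = woldProj (V₁.comp V₂) k :=
    apply_adj_woldProj (fun k => ⟨(q : ℂ) • V₁ (woldProj (V₁.comp V₂)
      (adj (V₁.comp V₂) k)), by
        rw [map_smul, ← h]
        exact (woldProj_adj _ _).symm⟩) k
  rw [woldProj_adj_comm h.woldProj_apply₂]
  exact congrArg V₁ h1.symm

/-- Likewise `V₂ = V₂V₁V₁* = q̄ V₁V₂V₁*` on the unitary part. -/
theorem QComm.woldProj_eq₂ (h : QComm q V₁ V₂) (k : K) : V₂ (woldProj (V₁.comp V₂) k) =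
    ((q⁻¹ : Circle) : ℂ) • (V₁.comp V₂) (woldProj (V₁.comp V₂) (adj V₁ k)) := by
  have h1 : V₁ (adj V₁ (woldProj (V₁.comp V₂) k)) = woldProj (V₁.comp V₂) k :=
    apply_adj_woldProj (fun k => ⟨V₂ (woldProj (V₁.comp V₂) (adj (V₁.comp V₂) k)),
      (woldProj_adj _ _).symm⟩) k
  rw [woldProj_adj_comm h.woldProj_apply₁]
  exact (congrArg V₂ h1.symm).trans (h.swap _)

end UnitaryPart

/-! ### Embedding the space of the canonical pair into the unitary part. -/

section Identification

variable {H : Type u} [NormedAddCommGroup H] [InnerProductSpace ℂ H]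
variable {K : Type w} [NormedAddCommGroup K] [InnerProductSpace ℂ K] [CompleteSpace K]
variable {𝒬 : Type v} [NormedAddCommGroup 𝒬] [InnerProductSpace ℂ 𝒬]
variable {W : 𝒬 ≃ₗᵢ[ℂ] 𝒬} {j : H →L[ℂ] 𝒬} {S : H →L[ℂ] H} {V : K →ₗᵢ[ℂ] K} {Φ : H →L[ℂ] K}

/-- The minimal unitary extension is isometrically embedded in the unitary part of the Wold
decomposition of a lift. -/
theorem exists_unitaryPart_isometry (hj : ∀ h, W (j (S h)) = j h)
    (htot : (Submodule.span ℂ (Set.range fun p : ℕ × H =>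
      (W ^ p.1) (j p.2))).topologicalClosure = ⊤)
    (hΦ : ∀ h, adj V (Φ h) = Φ (S h)) (hn : ∀ h, ‖j h‖ = ‖woldProj V (Φ h)‖) :
    ∃ s : 𝒬 →ₗᵢ[ℂ] K, ∀ n h, s ((W ^ n) (j h)) = V^[n] (woldProj V (Φ h)) := by
  obtain ⟨s, hs⟩ := exists_linearIsometry_of_inner_eq (fun p : ℕ × H => (W ^ p.1) (j p.2))
    (fun p : ℕ × H => V^[p.1] (woldProj V (Φ p.2))) htot (by
      rintro ⟨n, x⟩ ⟨m, y⟩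
      -- Both Gram matrices reduce to inner products of vectors indexed by `Sᵐ x` and `Sⁿ y`; these
      -- agree by polarization of `hn`.
      have h1 := inner_iterate_iterate (X := W.toLinearIsometry) (j := j) hj n m x y
      have h2 := inner_iterate_iterate (X := V) (j := fun h => woldProj V (Φ h)) (Y := S)
        (fun h => by rw [← hΦ, woldProj_adj]) n m x y
      simp only [coe_pow_isometryEquiv]
      refine h1.trans (Eq.trans ?_ h2.symm)
      exact inner_eq_of_norm_eq (woldProj V ∘L Φ).toLinearMap j.toLinearMap hn _ _)
  exact ⟨s, fun n h => hs (n, h)⟩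

/-- The lift controls only adjoints on the image of `H`, so `X` and `Y` enter through `X j = d W j
B` and its counterpart for `Y`. With `XWⁿ = cⁿWⁿX` and `YVⁿ = cⁿVⁿY`, both sides at `Wⁿ j h` become
`cⁿ d Vⁿ⁺¹` applied to the same vector. -/
theorem intertwine_of_isometry {s : 𝒬 →ₗᵢ[ℂ] K}
    (hs : ∀ n h, s ((W ^ n) (j h)) = V^[n] (woldProj V (Φ h)))
    (htot : (Submodule.span ℂ (Set.range fun p : ℕ × H =>
      (W ^ p.1) (j p.2))).topologicalClosure = ⊤)
    {X : 𝒬 ≃ₗᵢ[ℂ] 𝒬} {Y : K →ₗᵢ[ℂ] K} {B : H →L[ℂ] H} {c d : ℂ}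
    (hXW : ∀ x, X (W x) = c • W (X x)) (hYV : ∀ k, Y (V k) = c • V (Y k))
    (hX : ∀ h, X (j h) = d • W (j (B h)))
    (hY : ∀ h, Y (woldProj V (Φ h)) = d • V (woldProj V (Φ (B h)))) (x : 𝒬) :
    s (X x) = Y (s x) := by
  have hWs : ∀ x n (a : ℂ), W^[n] (a • x) = a • W^[n] x := fun x n a => by
    rw [← coe_pow_isometryEquiv, ← coe_pow_isometryEquiv, map_smul]
  have hVs : ∀ x n (a : ℂ), V^[n] (a • x) = a • V^[n] x := fun x n a => by
    have := map_smul (V.toLinearMap ^ n) a x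
    rwa [Module.End.coe_pow] at this
  have := clm_ext_of_total htot (A := s.toContinuousLinearMap ∘L unitaryOp X)
    (B := Y.toContinuousLinearMap ∘L s.toContinuousLinearMap) fun ⟨n, h⟩ => by
      change s (X ((W ^ n) (j h))) = Y (s ((W ^ n) (j h)))
      have h1 := qcomm_iterate (Y := W.toLinearEquiv.toLinearMap) hXW n (j h)
      have h2 := qcomm_iterate (Y := V.toLinearMap) hYV n (woldProj V (Φ h))
      change X (W^[n] (j h)) = c ^ n • W^[n] (X (j h)) at h1
      change Y (V^[n] _) = c ^ n • V^[n] _ at h2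
      rw [hs, h2, coe_pow_isometryEquiv, h1, hX, hY, hWs, hVs, ← Function.iterate_succ_apply,
        ← Function.iterate_succ_apply, map_smul, map_smul, ← coe_pow_isometryEquiv, hs]
  exact congr($this x)

end Identification

/-! ### Every minimal lift is a model. -/

section Converse

variable {H : Type u} [NormedAddCommGroup H] [InnerProductSpace ℂ H] [CompleteSpace H]
variable {q : Circle} {T₁ T₂ : H →L[ℂ] H}
variable {K : Type w} [NormedAddCommGroup K] [InnerProductSpace ℂ K] [CompleteSpace K]
variable {𝒬 : Type v} [NormedAddCommGroup 𝒬] [InnerProductSpace ℂ 𝒬]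
variable {V₁ V₂ : K →ₗᵢ[ℂ] K} {Φ : H →ₗᵢ[ℂ] K}

/-- Inverting `W₁*W₂* = qW_D*` gives `W_D = qW₂W₁`, which is `W₁W₂`. -/
theorem CanonicalPair.WD_eq (hT : IsQContractivePair q T₁ T₂) (W : CanonicalPair hT 𝒬) (x : 𝒬) :
    W.WD x = W.W₁ (W.W₂ x) := by
  have h := W.prod_eq (W.WD x)
  rw [W.WD.symm_apply_apply, LinearIsometryEquiv.symm_apply_eq, LinearIsometryEquiv.symm_apply_eq,
    map_smul, map_smul, ← W.qcomm] at h
  exact h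

/-- The embedding `h ↦ Q_{T*} h`. -/
def CanonicalPair.embed {hT : IsQContractivePair q T₁ T₂} (W : CanonicalPair hT 𝒬) : H →L[ℂ] 𝒬 :=
  W.ι.toContinuousLinearMap ∘L toClosedRange (Qop (T₁ * T₂) hT.norm_mul_le)

theorem CanonicalPair.total {hT : IsQContractivePair q T₁ T₂} (W : CanonicalPair hT 𝒬) :
    (Submodule.span ℂ (Set.range fun p : ℕ × H =>
      (W.WD ^ p.1) (W.embed p.2))).topologicalClosure = ⊤ := by
  rw [eq_top_iff, ← W.WD_minimal]
  refine Submodule.topologicalClosure_minimal _ (Submodule.span_le.2 ?_)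
    (Submodule.isClosed_topologicalClosure _)
  rintro _ ⟨⟨n, r⟩, rfl⟩
  refine (denseRange_toClosedRange (Qop (T₁ * T₂) hT.norm_mul_le)).induction_on
    (p := fun r => (W.WD ^ n) (W.ι r) ∈ (Submodule.span ℂ (Set.range fun p : ℕ × H =>
      (W.WD ^ p.1) (W.embed p.2))).topologicalClosure) r ?_ fun h => ?_
  · exact (Submodule.isClosed_topologicalClosure _).preimage
      ((W.WD ^ n).continuous.comp W.ι.continuous)
  · exact Submodule.le_topologicalClosure _ (Submodule.subset_span ⟨(n, h), rfl⟩)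

theorem adj_comp_lift (h₁ : ∀ h, adj V₁ (Φ h) = Φ (adjoint T₁ h))
    (h₂ : ∀ h, adj V₂ (Φ h) = Φ (adjoint T₂ h)) (h : H) :
    adj (V₁.comp V₂) (Φ h) = Φ (adjoint (T₁ * T₂) h) := by
  rw [adj_comp, h₁, h₂, adjoint_mul, mul_apply_eq_comp]

theorem pow_adj_comp_lift (h₁ : ∀ h, adj V₁ (Φ h) = Φ (adjoint T₁ h))
    (h₂ : ∀ h, adj V₂ (Φ h) = Φ (adjoint T₂ h)) (n : ℕ) (h : H) :
    (adj (V₁.comp V₂) ^ n) (Φ h) = Φ ((adjoint (T₁ * T₂) ^ n) h) := by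
  induction n generalizing h with
  | zero => rfl
  | succ n ih =>
    rw [pow_succ, mul_apply_eq_comp, adj_comp_lift h₁ h₂, ih, pow_succ (adjoint _),
      mul_apply_eq_comp]

/-- Both squares equal `‖h‖² - ‖T*h‖²`. This is what makes `Λ_*` well defined and isometric. -/
theorem norm_coProj_lift (hT : IsQContractivePair q T₁ T₂)
    (h₁ : ∀ h, adj V₁ (Φ h) = Φ (adjoint T₁ h)) (h₂ : ∀ h, adj V₂ (Φ h) = Φ (adjoint T₂ h))
    (h : H) : ‖coProj (V₁.comp V₂) (Φ h)‖ = ‖toDefect (adjoint (T₁ * T₂)) h‖ := by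
  rw [← sq_eq_sq₀ (norm_nonneg _) (norm_nonneg _),
    norm_toDefect_sq (norm_adjoint_le hT.norm_mul_le)]
  have h3 := norm_coProj_sq (V₁.comp V₂) (Φ h)
  rw [Φ.norm_map] at h3
  have h4 : ‖adj (V₁.comp V₂) (Φ h)‖ = ‖adjoint (T₁ * T₂) h‖ := by
    rw [adj_comp_lift h₁ h₂, Φ.norm_map]
  rw [← h4]
  linarith

/-- The Andô tuple of a lift, on the wandering subspace of `V₁ V₂`. -/
def liftAndoTuple (hq : QComm q V₁ V₂) (h₁ : ∀ h, adj V₁ (Φ h) = Φ (adjoint T₁ h))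
    (h₂ : ∀ h, adj V₂ (Φ h) = Φ (adjoint T₂ h))
    (Λ : defectSpace (adjoint (T₁ * T₂)) →ₗᵢ[ℂ] wandering V₁ V₂)
    (hΛ : ∀ h, Λ (toDefect (adjoint (T₁ * T₂)) h) = coProj (V₁.comp V₂) (Φ h)) :
    AndoTuple q T₁ T₂ (wandering V₁ V₂) where
  Λ := Λ
  P := wanderingProj hq
  U := flipEquiv hq
  isProj := isStarProjection_wanderingProj hq
  rel₁ h := by
    rw [hΛ, hΛ, hΛ, ← h₁, ← adj_comp_lift h₁ h₂]
    exact coProj_adj₁ hq (Φ h)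
  rel₂ h := by
    rw [hΛ, hΛ, hΛ, ← h₂, ← adj_comp_lift h₁ h₂]
    exact coProj_adj₂ hq (Φ h)

/-- One factor `V* = V₂*V₁*` is spent on `V₁*V₁ = I`, leaving `V*ⁿV₂*`; only the `n` remaining
factors are commuted past `V₂*`. -/
theorem adj_pow_apply₁ (hq : QComm q V₁ V₂) (n : ℕ) (k : K) :
    (adj (V₁.comp V₂) ^ (n + 1)) (V₁ k) =
      (q : ℂ) ^ n • adj V₂ ((adj (V₁.comp V₂) ^ n) k) := by
  rw [pow_succ, mul_apply_eq_comp, adj_comp, adjoint_apply_isometry]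
  refine congr($(pow_mul_of_qcomm (A := adj V₂) (B := adj (V₁.comp V₂)) (c := (q : ℂ))
    (ContinuousLinearMap.ext fun k => ?_) n) k)
  change adj (V₁.comp V₂) (adj V₂ k) = (q : ℂ) • adj V₂ (adj (V₁.comp V₂) k)
  rw [adj_comp, adj_comp, hq.adj_adj, map_smul]

/-- Here `V₂*V₁*V₂ = q̄V₁*`, so the factor spent also contributes a `q̄`, whence the exponent `n +
1`. -/
theorem adj_pow_apply₂ (hq : QComm q V₁ V₂) (n : ℕ) (k : K) :
    (adj (V₁.comp V₂) ^ (n + 1)) (V₂ k) =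
      ((q⁻¹ : Circle) : ℂ) ^ (n + 1) • adj V₁ ((adj (V₁.comp V₂) ^ n) k) := by
  have h := congr($(pow_mul_of_qcomm (A := adj V₁) (B := adj (V₁.comp V₂))
    (c := ((q⁻¹ : Circle) : ℂ)) (ContinuousLinearMap.ext fun k => by
      change adj (V₁.comp V₂) (adj V₁ k) = ((q⁻¹ : Circle) : ℂ) • adj V₁ (adj (V₁.comp V₂) k)
      rw [adj_comp, adj_comp, hq.swap.adj_adj]) n) k)
  rw [mul_apply_eq_comp, smul_apply, mul_apply_eq_comp] at h
  rw [pow_succ, mul_apply_eq_comp, adj_comp, hq.adj_adj_apply, map_smul, h, smul_smul, pow_succ']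

/-- In positive degree `V₁` cancels against one `V*` and leaves `V₂*`. So the identity for `V₂*`
gives the model form of `V₁`, and in `shiftPart_apply₂` the one for `V₁*` gives that of `V₂`; degree
`0` is treated separately. -/
theorem shiftPart_apply₁ (hq : QComm q V₁ V₂) (k : K) : shiftPart (V₁.comp V₂) (V₁ k) =
    (mulOp (unitaryOp (flipEquiv hq).symm * (1 - wanderingProj hq))
      (unitaryOp (flipEquiv hq).symm * wanderingProj hq) * rotation (wandering V₁ V₂) q)
        (shiftPart (V₁.comp V₂) k) := by
  refine H2.ext fun n => ?_
  rw [mul_apply_eq_comp]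
  cases n with
  | zero =>
    rw [mulOp_apply_zero, rotation_apply, pow_zero, one_smul]
    exact coProj_apply₁ hq k
  | succ n =>
    rw [mulOp_apply_succ, rotation_apply, rotation_apply, map_smul, map_smul, shiftPart_apply,
      adj_pow_apply₁ hq, map_smul, coProj_adj₂ hq, pow_succ, shiftPart_apply, shiftPart_apply,
      pow_succ' (adj _), mul_apply_eq_comp, mul_smul, ← smul_add]
    exact congrArg ((q : ℂ) ^ n • ·) (add_comm _ _)

theorem shiftPart_apply₂ (hq : QComm q V₁ V₂) (k : K) : shiftPart (V₁.comp V₂) (V₂ k) =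
    (rotation (wandering V₁ V₂) q⁻¹ * mulOp (wanderingProj hq * unitaryOp (flipEquiv hq))
      ((1 - wanderingProj hq) * unitaryOp (flipEquiv hq))) (shiftPart (V₁.comp V₂) k) := by
  refine H2.ext fun n => ?_
  rw [mul_apply_eq_comp, rotation_apply]
  cases n with
  | zero =>
    rw [mulOp_apply_zero, pow_zero, one_smul]
    exact coProj_apply₂ hq k
  | succ n =>
    rw [mulOp_apply_succ, shiftPart_apply, adj_pow_apply₂ hq, map_smul, coProj_adj₁ hq,
      shiftPart_apply, shiftPart_apply, pow_succ' (adj _), mul_apply_eq_comp]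
    exact congrArg (((q⁻¹ : Circle) : ℂ) ^ (n + 1) • ·) (add_comm _ _)

variable [CompleteSpace 𝒬]

/-- The shift part and a coisometry onto `𝒬` with initial projection the projection onto the unitary
part make up a unitary onto `H² ⊕ 𝒬`. -/
theorem exists_wold_unitary (V : K →ₗᵢ[ℂ] K) (s : 𝒬 →ₗᵢ[ℂ] K)
    (hs : ∀ k, s (adjoint s.toContinuousLinearMap k) = woldProj V k) :
    ∃ τ : K ≃ₗᵢ[ℂ] DSum (H2 (adj V).ker) 𝒬, ∀ k,
      τ k = WithLp.toLp 2 (shiftPart V k, adjoint s.toContinuousLinearMap k) := by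
  set r := adjoint s.toContinuousLinearMap with hr
  have hrs : ∀ x, r (s x) = x := fun x => ext_inner_left ℂ fun y => by
    rw [hr, adjoint_inner_right]
    exact s.inner_map_map y x
  have hnorm : ∀ k, ‖r k‖ = ‖woldProj V k‖ := fun k => by rw [← hs, s.norm_map]
  let τ₀ : K →ₗᵢ[ℂ] DSum (H2 (adj V).ker) 𝒬 :=
    ⟨(WithLp.linearEquiv 2 ℂ (H2 (adj V).ker × 𝒬)).symm.toLinearMap ∘ₗ
      (shiftPart V).prod r.toLinearMap, fun k => by
        rw [← sq_eq_sq₀ (norm_nonneg _) (norm_nonneg _), dsum_norm_sq, ← norm_shiftPart_sq V k,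
          ← norm_woldProj, ← hnorm]
        rfl⟩
  have hτ : ∀ k, τ₀ k = WithLp.toLp 2 (shiftPart V k, r k) := fun k => rfl
  -- An isometry on a complete space has closed range, so it suffices to reach the vectors `zⁿ a ⊕
  -- 0` and `0 ⊕ x`.
  have hclosed : IsClosed (LinearMap.range τ₀.toLinearMap : Set (DSum (H2 (adj V).ker) 𝒬)) := by
    rw [LinearMap.coe_range]
    exact τ₀.isometry.isClosedEmbedding.isClosed_range
  let i : H2 (adj V).ker →L[ℂ] DSum (H2 (adj V).ker) 𝒬 := column (ContinuousLinearMap.id ℂ _) 0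
  have h1 : ∀ f, i f ∈ LinearMap.range τ₀.toLinearMap := fun f =>
    single_mem_induction (S := (LinearMap.range τ₀.toLinearMap).comap i.toLinearMap)
      (hclosed.preimage i.continuous) (fun n a => ⟨V^[n] (a : K), by
        refine (hτ _).trans (dsum_ext (shiftPart_iterate_coe V n a) ?_)
        change r _ = 0
        rw [← norm_eq_zero, hnorm, norm_eq_zero]
        induction n with
        | zero => exact woldProj_of_mem_ker V a.2
        | succ n ih => rw [Function.iterate_succ_apply', woldProj_apply, ih, map_zero]⟩) f
  have hsurj : Function.Surjective τ₀ := fun y => by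
    obtain ⟨k, hk⟩ := h1 y.fst
    refine ⟨k + s y.snd, ?_⟩
    have h2 : τ₀ (s y.snd) = WithLp.toLp 2 (0, y.snd) := by
      rw [hτ, hrs]
      congr 2
      have h3 : s y.snd = woldProj V (s y.snd) := by rw [← hs, hrs]
      rw [h3, shiftPart_woldProj]
    rw [map_add, h2]
    refine (congrArg (· + _) hk).trans ?_
    exact dsum_ext (add_zero _) (zero_add _)
  exact ⟨LinearIsometryEquiv.ofSurjective τ₀ hsurj, hτ⟩

/-- The unitary is `k ↦ shiftPart k ⊕ s*k`, where `s` embeds `𝒬` into the unitary part of `V₁V₂`.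
What has to be shown is that `s` intertwines the canonical pair with `(V₁, V₂)` and fills the
unitary part. -/
theorem exists_model (hT : IsQContractivePair q T₁ T₂) (W : CanonicalPair hT 𝒬)
    (hq : QComm q V₁ V₂) (h₁ : ∀ h, adj V₁ (Φ h) = Φ (adjoint T₁ h))
    (h₂ : ∀ h, adj V₂ (Φ h) = Φ (adjoint T₂ h))
    (hmin : (Submodule.span ℂ (Set.range fun p : ℕ × ℕ × H =>
      V₁^[p.1] (V₂^[p.2.1] (Φ p.2.2)))).topologicalClosure = ⊤) :
    ∃ (A : AndoTuple q T₁ T₂ (wandering V₁ V₂)) (τ : K ≃ₗᵢ[ℂ] DSum (H2 (wandering V₁ V₂)) 𝒬),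
      (∀ k, τ (V₁ k) = modelV₁ q A.P A.U W.W₁ (τ k)) ∧
      (∀ k, τ (V₂ k) = modelV₂ q A.P A.U W.W₂ (τ k)) ∧
      (∀ h, τ (Φ h) = modelEmbedding hT W A.Λ h) := by
  obtain ⟨Λ, hΛ⟩ := exists_linearIsometry_of_norm_eq (toDefect (adjoint (T₁ * T₂))).toLinearMap
    (coProj (V₁.comp V₂) ∘L Φ.toContinuousLinearMap).toLinearMap (denseRange_toClosedRange _)
    (norm_coProj_lift hT h₁ h₂)
  have hlift := adj_comp_lift h₁ h₂
  have hWD : ∀ h, W.WD (W.embed (adjoint (T₁ * T₂) h)) = W.embed h := fun h => by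
    rw [← LinearIsometryEquiv.eq_symm_apply]
    exact (W.WD_extends h).symm
  have hnorm : ∀ h, ‖W.embed h‖ = ‖woldProj (V₁.comp V₂) (Φ h)‖ := fun h => by
    rw [norm_woldProj]
    refine (W.ι.norm_map _).trans ?_
    change ‖Qop (T₁ * T₂) hT.norm_mul_le h‖ = _
    rw [← sq_eq_sq₀ (norm_nonneg _) (norm_nonneg _)]
    refine tendsto_nhds_unique (norm_Qop_sq _ _) ((norm_Qop_sq _ _).congr fun n => ?_)
    rw [pow_adj_comp_lift h₁ h₂, Φ.norm_map]
  obtain ⟨s, hs⟩ := exists_unitaryPart_isometry (Φ := Φ.toContinuousLinearMap) hWD W.total hlift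
    hnorm
  have hs0 : ∀ h, s (W.embed h) = woldProj (V₁.comp V₂) (Φ h) := hs 0
  have hsV₁ : ∀ x, s (W.W₁ x) = V₁ (s x) := by
    -- The data come from `W₁ = W_D W₂*` and `W₁W_D = qW_D W₁`.
    refine intertwine_of_isometry hs W.total (c := q) (d := 1) (B := adjoint T₂) (fun x => ?_)
      (fun k => ?_) (fun h => ?_) (fun h => ?_)
    · rw [W.WD_eq, W.WD_eq, ← map_smul, W.qcomm]
    · exact (congrArg V₁ (hq k)).trans (map_smul V₁ _ _)
    · rw [one_smul, W.WD_eq]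
      refine congrArg W.W₁ ?_
      rw [← LinearIsometryEquiv.symm_apply_eq]
      exact W.W₂_extends h
    · rw [one_smul]
      exact (hq.woldProj_eq₁ (Φ h)).trans (by rw [h₂]; rfl)
  have hsV₂ : ∀ x, s (W.W₂ x) = V₂ (s x) := by
    have hqi : ∀ x, W.W₂ (W.W₁ x) = ((q⁻¹ : Circle) : ℂ) • W.WD x := fun x => by
      rw [W.WD_eq, W.qcomm, smul_smul, circle_inv_mul, one_smul]
    -- The data come from `W₂ = q̄ W_D W₁*` and `W₂W_D = q̄ W_D W₂`.
    refine intertwine_of_isometry hs W.total (c := (q⁻¹ : Circle)) (d := (q⁻¹ : Circle))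
      (B := adjoint T₁) (fun x => ?_) (fun k => hq.swap (V₂ k)) (fun h => ?_) (fun h => ?_)
    · rw [W.WD_eq, hqi]
    · rw [← hqi]
      refine congrArg W.W₂ ?_
      rw [← LinearIsometryEquiv.symm_apply_eq]
      exact W.W₁_extends h
    · exact (hq.woldProj_eq₂ (Φ h)).trans (by rw [h₁]; rfl)
  set r := adjoint s.toContinuousLinearMap with hr
  have hrs : ∀ x, r (s x) = x := fun x => ext_inner_left ℂ fun y => by
    rw [hr, adjoint_inner_right]
    exact s.inner_map_map y x
  have hAs : ∀ x, woldProj (V₁.comp V₂) (s x) = s x := fun x => by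
    have := clm_ext_of_total W.total (A := woldProj (V₁.comp V₂) ∘L s.toContinuousLinearMap)
      (B := s.toContinuousLinearMap) fun ⟨n, h⟩ => by
        change woldProj (V₁.comp V₂) (s ((W.WD ^ n) (W.embed h))) = s ((W.WD ^ n) (W.embed h))
        rw [hs]
        induction n with
        | zero => exact woldProj_woldProj (V₁.comp V₂) _
        | succ n ih => rw [Function.iterate_succ_apply', woldProj_apply, ih]
    exact congr($this x)
  have hrA : ∀ k, r (woldProj (V₁.comp V₂) k) = r k := fun k => ext_inner_left ℂ fun x => by
    rw [hr, adjoint_inner_right, adjoint_inner_right, ← adjoint_inner_left, adjoint_woldProj]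
    exact congrArg (inner ℂ · k) (hAs x)
  have hV₁n : ∀ n x, ∃ y, V₁^[n] (s x) = s y := fun n x => by
    induction n with
    | zero => exact ⟨x, rfl⟩
    | succ n ih =>
      obtain ⟨y, hy⟩ := ih
      exact ⟨W.W₁ y, by rw [Function.iterate_succ_apply', hy, hsV₁]⟩
  have hV₂n : ∀ n x, ∃ y, V₂^[n] (s x) = s y := fun n x => by
    induction n with
    | zero => exact ⟨x, rfl⟩
    | succ n ih =>
      obtain ⟨y, hy⟩ := ih
      exact ⟨W.W₂ y, by rw [Function.iterate_succ_apply', hy, hsV₂]⟩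
  have hA₁ : ∀ n k, woldProj (V₁.comp V₂) (V₁^[n] k) = V₁^[n] (woldProj (V₁.comp V₂) k) := fun n k => by
    induction n with
    | zero => rfl
    | succ n ih => rw [Function.iterate_succ_apply', hq.woldProj_apply₁, ih,
        Function.iterate_succ_apply']
  have hA₂ : ∀ n k, woldProj (V₁.comp V₂) (V₂^[n] k) = V₂^[n] (woldProj (V₁.comp V₂) k) := fun n k => by
    induction n with
    | zero => rfl
    | succ n ih => rw [Function.iterate_succ_apply', hq.woldProj_apply₂, ih,
        Function.iterate_succ_apply']
  -- Minimality enters here. The unitary part of `V₁ᵐV₂ⁿΦh` is `V₁ᵐV₂ⁿ s(Q_{T*}h)`, which stays in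
  -- the range of `s` because `s` intertwines; such vectors are total in the unitary part, so `s` is
  -- onto it.
  have hsr : ∀ k, s (r k) = woldProj (V₁.comp V₂) k := fun k => by
    have := clm_ext_of_total hmin (A := s.toContinuousLinearMap ∘L r ∘L woldProj (V₁.comp V₂))
      (B := woldProj (V₁.comp V₂)) fun ⟨m, n, h⟩ => by
        change s (r (woldProj (V₁.comp V₂) _)) = woldProj (V₁.comp V₂) _
        rw [hA₁, hA₂, ← hs0]
        obtain ⟨y, hy⟩ := hV₂n n (W.embed h)
        obtain ⟨z, hz⟩ := hV₁n m y
        rw [hy, hz, hrs]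
    rw [← hrA]
    exact congr($this k)
  have hr₁ : ∀ k, r (V₁ k) = W.W₁ (r k) := fun k => by
    rw [← hrA, hq.woldProj_apply₁, ← hsr, ← hsV₁, hrs]
  have hr₂ : ∀ k, r (V₂ k) = W.W₂ (r k) := fun k => by
    rw [← hrA, hq.woldProj_apply₂, ← hsr, ← hsV₂, hrs]
  obtain ⟨τ, hτ⟩ := exists_wold_unitary (V₁.comp V₂) s hsr
  refine ⟨liftAndoTuple hq h₁ h₂ Λ hΛ, τ, fun k => ?_, fun k => ?_, fun h => ?_⟩
  · rw [hτ, hτ]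
    exact dsum_ext (shiftPart_apply₁ hq k) (hr₁ k)
  · rw [hτ, hτ]
    exact dsum_ext (shiftPart_apply₂ hq k) (hr₂ k)
  · rw [hτ]
    refine dsum_ext (H2.ext fun n => ?_) ?_
    · rw [modelEmbedding_fst]
      change coProj (V₁.comp V₂) ((adj (V₁.comp V₂) ^ n) (Φ h)) = Λ _
      rw [pow_adj_comp_lift h₁ h₂]
      exact (hΛ _).symm
    · rw [modelEmbedding_snd]
      change r (Φ h) = W.embed h
      rw [← hrA, ← hs0, hrs]

end Converse

end QDouglas

end

theorem theoremT {H : Type u} [NormedAddCommGroup H] [InnerProductSpace ℂ H]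
    [CompleteSpace H] (q : Circle) (T₁ T₂ : H →L[ℂ] H) (hT : IsQContractivePair q T₁ T₂) :
    -- the canonical pair of unitaries and a special Andô tuple exist
    (∃ (𝒬 : Type u) (_ : NormedAddCommGroup 𝒬) (_ : InnerProductSpace ℂ 𝒬)
      (_ : CompleteSpace 𝒬), Nonempty (CanonicalPair hT 𝒬)) ∧
    (∃ (E : Type u) (_ : NormedAddCommGroup E) (_ : InnerProductSpace ℂ E)
      (_ : CompleteSpace E), Nonempty (SpecialAndoTuple T₁ T₂ E)) ∧
    -- for the canonical pair of unitaries: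
    (∀ (𝒬 : Type v) [NormedAddCommGroup 𝒬] [InnerProductSpace ℂ 𝒬] [CompleteSpace 𝒬]
      (W : CanonicalPair hT 𝒬),
      -- the model built from any special Andô tuple is a `q`-commuting isometric lift
      (∀ (E : Type w) [NormedAddCommGroup E] [InnerProductSpace ℂ E] [CompleteSpace E]
        (A : SpecialAndoTuple T₁ T₂ E),
        IsIsometricLift q T₁ T₂ (modelEmbedding hT W A.Λ)
          (modelV₁ q A.P A.U W.W₁) (modelV₂ q A.P A.U W.W₂)) ∧
      -- every minimal `q`-commuting isometric lift is unitarily equivalent to such a model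
      (∀ (K : Type w) [NormedAddCommGroup K] [InnerProductSpace ℂ K] [CompleteSpace K]
        (Φ : H →L[ℂ] K) (V₁ V₂ : K →L[ℂ] K),
        IsIsometricLift q T₁ T₂ Φ V₁ V₂ → IsMinimalLift Φ V₁ V₂ →
        ∃ (F : Type w) (_ : NormedAddCommGroup F) (_ : InnerProductSpace ℂ F)
          (_ : CompleteSpace F) (A : AndoTuple q T₁ T₂ F) (τ : K ≃ₗᵢ[ℂ] DSum (H2 F) 𝒬),
          (∀ k, τ (V₁ k) = modelV₁ q A.P A.U W.W₁ (τ k)) ∧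
          (∀ k, τ (V₂ k) = modelV₂ q A.P A.U W.W₂ (τ k)) ∧
          (∀ h, τ (Φ h) = modelEmbedding hT W A.Λ h))) := by
  refine ⟨exists_canonicalPair hT, ⟨_, _, _, inferInstance, exists_specialAndoTuple hT⟩, ?_⟩
  intro 𝒬 _ _ _ W
  refine ⟨fun E _ _ _ A => isIsometricLift_model hT W (A.toAndoTuple hT), ?_⟩
  intro K _ _ _ Φ V₁ V₂ hL hmin
  let X₁ : K →ₗᵢ[ℂ] K := ⟨V₁.toLinearMap, fun x =>
    hL.isometry₁.norm_map_of_map_zero (map_zero V₁) x⟩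
  let X₂ : K →ₗᵢ[ℂ] K := ⟨V₂.toLinearMap, fun x =>
    hL.isometry₂.norm_map_of_map_zero (map_zero V₂) x⟩
  let Ψ : H →ₗᵢ[ℂ] K := ⟨Φ.toLinearMap, fun x =>
    hL.isometry_embedding.norm_map_of_map_zero (map_zero Φ) x⟩
  have hq : QComm q X₁ X₂ := fun k => congr($(hL.qcomm) k)
  have h₁ : ∀ h, adj X₁ (Ψ h) = Ψ (adjoint T₁ h) := fun h => congr($(hL.lift₁) h)
  have h₂ : ∀ h, adj X₂ (Ψ h) = Ψ (adjoint T₂ h) := fun h => congr($(hL.lift₂) h)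
  obtain ⟨A, τ, e₁, e₂, e₃⟩ := exists_model hT W hq h₁ h₂ (by
    simp only [IsMinimalLift, FunLike.coe_pow_eq_iterate] at hmin
    exact hmin)
  exact ⟨wandering X₁ X₂, inferInstance, inferInstance, inferInstance, A, τ, e₁, e₂, e₃⟩
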